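/- Let $(X,\mu)$ be a standard Borel probability space, $(Y,p)$ a probability space, $\Omega=Y^{\mathbb Z}$ with $\mathbb P=p^{\mathbb Z}$, $\theta$ the shift on $\Omega$, $\bar X=\Omega\times X$ and $\bar\mu=\mathbb P\times\mu$. Let $\bar f:\bar X\to\bar X$, $\bar f(\omega,x)=(\theta\omega,f_{\omega_0}(x))$, be an invertible measurable skew-shift for which $\bar\mu$ is invariant and ergodic. A random $\mathrm{GL}(d)$-valued cocycle $(\bar f,A)$ is given by a family of maps $A_i:X\to\mathrm{GL}(d)$, $i\in Y$, such that $(i,x)\mapsto A_i(x)$ is measurable; one writes $A(\omega,x)=A_{\omega_0}(x)$, $A^0=\mathrm{id}$ and $A^n(\bar x)=A(\bar f^{\,n-1}(\bar x))\cdots A(\bar f(\bar x))A(\bar x)$ for $n>0$. The cocycle is essentially bounded if there are a compact set $K\subset\mathrm{GL}(d)$, a constant $\delta>0$ and a measurable set $E\subset\bar X$ with $\bar\mu(E)>0$ such that $$\liminf_{n\to\infty}\frac{\#\{0\le m\le n:\ A^m(\bar x)\in K\}}{n}\ \ge\ \delta\qquad\text{for all }\bar x\in E.$$ Two random cocycles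 $(\bar f,A)$, $(\bar f,B)$ are cohomologous if there is a measurable $P:X\to\mathrm{GL}(d)$ with $B(\omega,x)=P(f_{\omega_0}(x))^{-1}A(\omega,x)P(x)$ for $\bar\mu$-almost every $(\omega,x)$. Put $F_i(x,z)=(f_i(x),B_i(x)z)$ on $X\times\mathbb P(\mathbb R^d)$. A measure $\hat\mu$ on $X\times\mathbb P(\mathbb R^d)$ that projects to $\mu$ is called $(\bar f,B)$-stationary if $\int_Y (F_i)_*\hat\mu\,dp(i)=\hat\mu$, and $(\bar f,B)$-invariant if $(F_i)_*\hat\mu=\hat\mu$ for $p$-almost every $i$. Proposition. Let $(\bar f,A)$ be an essentially bounded random $\mathrm{GL}(d)$-valued cocycle. Then there are a compact subgroup $H$ of $\mathrm{GL}(d)$, contained in $\mathrm O(d)$, and a random cocycle $(\bar f,B)$ with values in $H$ and cohomologous to $(\bar f,A)$, such that every $(\bar f,B)$-stationary probability measure $\hat\mu$ on $X\times\mathbb P(\mathbb R^d)$ is of the form $\hat\mu=\mu\times\nu$ with $\nu$ a probability measure on $\mathbb P(\mathbb R^d)$, and is $(\bar f,B)$-invariant. -/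

import Mathlib

open MeasureTheory Filter Topology
open scoped LinearAlgebra.Projectivization Matrix MatrixGroups

noncomputable section

/-- The Borel σ-algebra of the topological group `GL(d)`. -/
instance glMeasurableSpace (d : ℕ) : MeasurableSpace (GL (Fin d) ℝ) := borel _

/-- The quotient topology on the projective space of `ℝ^d`, seen as the set of nonzero vectors
modulo nonzero scalars. -/
instance projectiveTopology (d : ℕ) : TopologicalSpace (ℙ ℝ (Fin d → ℝ)) :=
  TopologicalSpace.coinduced
    (fun v : {v : Fin d → ℝ // v ≠ 0} => Projectivization.mk ℝ v.1 v.2) inferInstance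

/-- The Borel σ-algebra of the projective space. -/
instance projectiveMeasurableSpace (d : ℕ) : MeasurableSpace (ℙ ℝ (Fin d → ℝ)) := borel _

/-- The action of `GL(d)` on the projective space is the usual one, `g [v] = [g v]`. -/
theorem gl_smul_mk {d : ℕ} (g : GL (Fin d) ℝ) (v : Fin d → ℝ) (hv : v ≠ 0)
    (hgv : (g : Matrix (Fin d) (Fin d) ℝ) *ᵥ v ≠ 0) :
    g • Projectivization.mk ℝ v hv =
      Projectivization.mk ℝ ((g : Matrix (Fin d) (Fin d) ℝ) *ᵥ v) hgv := rfl

/-- The skew-shift `(ω, x) ↦ (θ ω, f_{ω₀}(x))` on `Y^ℤ × X`, where `(θ ω)_n = ω_{n+1}`. -/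
def skewShift {Y X : Type*} (f : Y → X → X) (z : (ℤ → Y) × X) : (ℤ → Y) × X :=
  (fun n => z.1 (n + 1), f (z.1 0) z.2)

/-- The measure `p^ℤ × μ` on `Y^ℤ × X`. -/
def skewMeasure {Y X : Type*} [MeasurableSpace Y] [MeasurableSpace X]
    (p : Measure Y) (μ : Measure X) : Measure ((ℤ → Y) × X) :=
  (Measure.infinitePi (fun _ : ℤ => p)).prod μ

/-- A random transformation: an invertible measurable skew-shift which preserves `p^ℤ × μ` and is
ergodic for it (`Ergodic` contains measurability and invariance of the measure). -/
structure RandomTransformation {Y X : Type*} [MeasurableSpace Y] [MeasurableSpace X]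
    (p : Measure Y) (μ : Measure X) where
  map : Y → X → X
  bijective : Function.Bijective (skewShift map)
  ergodic : Ergodic (skewShift map) (skewMeasure p μ)

/-- A random `G`-valued cocycle over `f`: a cocycle `A(ω, x) = A_{ω₀}(x)` on `Y^ℤ × X`, given by
the family `A_i : X → G`, `i ∈ Y`, measurable in `(i, x)`. -/
structure RandomCocycle {Y X : Type*} [MeasurableSpace Y] [MeasurableSpace X]
    {p : Measure Y} {μ : Measure X} (f : RandomTransformation p μ)
    (G : Type*) [MeasurableSpace G] where
  map : Y → X → G
  measurable : Measurable (fun z : Y × X => map z.1 z.2)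

namespace RandomCocycle

variable {Y X : Type*} [MeasurableSpace Y] [MeasurableSpace X]
  {p : Measure Y} {μ : Measure X} {f : RandomTransformation p μ}
  {G : Type*} [Group G] [MeasurableSpace G]

/-- The cocycle as a function on `Y^ℤ × X`. -/
def eval (A : RandomCocycle f G) (z : (ℤ → Y) × X) : G := A.map (z.1 0) z.2

/-- `A^n(z) = A(f̄^{n-1} z) ⋯ A(f̄ z) A(z)`. -/
def iter (A : RandomCocycle f G) : ℕ → (ℤ → Y) × X → G
  | 0, _ => 1
  | n + 1, z => A.eval ((skewShift f.map)^[n] z) * A.iter n z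

/-- The lower asymptotic density `liminf #([0,n] ∩ D) / n` of a set of natural numbers. -/
def lowerDensity (D : Set ℕ) : ℝ :=
  liminf (fun n : ℕ => ((Set.Icc 0 n ∩ D).ncard : ℝ) / (n : ℝ)) atTop

/-- Essentially bounded: on a set of positive measure, the times at which `A^n` lies in a fixed
compact subset of the group have lower density at least `δ > 0`. -/
def EssentiallyBounded [TopologicalSpace G] (A : RandomCocycle f G) : Prop :=
  ∃ (K : Set G) (δ : ℝ) (E : Set ((ℤ → Y) × X)),
    IsCompact K ∧ 0 < δ ∧ MeasurableSet E ∧ 0 < skewMeasure p μ E ∧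
      ∀ z ∈ E, δ ≤ lowerDensity {n : ℕ | A.iter n z ∈ K}

/-- Random cocycles over the same base are cohomologous if they are conjugate through a measurable
map `P : X → G`, which does not depend on `ω`. -/
def Cohomologous (A B : RandomCocycle f G) : Prop :=
  ∃ P : X → G, Measurable P ∧ ∀ᵐ z ∂(skewMeasure p μ),
    B.eval z = (P (f.map (z.1 0) z.2))⁻¹ * A.eval z * P z.2

section Action

variable {Z : Type*} [MeasurableSpace Z] [MulAction G Z]

/-- The fibred map `F_i(x, z) = (f_i(x), A_i(x) z)` on `X × Z`. -/
def fiberMap (A : RandomCocycle f G) (i : Y) (w : X × Z) : X × Z :=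
  (f.map i w.1, A.map i w.1 • w.2)

/-- `π` projects on `μ` and `F_i π = π` for almost every `i`. -/
def IsInvariant (A : RandomCocycle f G) (π : Measure (X × Z)) : Prop :=
  π.map Prod.fst = μ ∧ ∀ᵐ i ∂p, π.map (A.fiberMap i) = π

/-- `π` projects on `μ` and `∫ F_i π dp(i) = π`. -/
def IsStationary (A : RandomCocycle f G) (π : Measure (X × Z)) : Prop :=
  π.map Prod.fst = μ ∧
    ∀ S : Set (X × Z), MeasurableSet S → ∫⁻ i, π.map (A.fiberMap i) S ∂p = π S

end Action

end RandomCocycle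

end

/-!
The proof takes place in `L²(X × G, μ × haar)`, where `G = GL(d)`. The cocycle acts on `X × G` by
`(i, (x, g)) ↦ (f_i(x), A_i(x) g)`, and the transfer operator `T` of this random walk
(`transferOp`) sends the density of an initial law to the density of the law after one step. It is
a product `J* I` with `I` and `J` isometries, so a vector fixed by `T` is invariant under almost
every step, by the equality case of the Cauchy-Schwarz inequality (`transferOp_eq_self_iff`).

*An invariant function exists.* The density of `μ × haar|U`, with `U` a compact neighbourhood of
`1`, has Cesàro averages under `T` that converge to a `T`-fixed vector, by the mean ergodic theorem.
At time `n` the set `X × KU` has mass at least `haar(U)` times the probability that `Aⁿ ∈ K`.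
Essential boundedness prevents these probabilities from tending to zero in mean, so the limit is not
zero (`RandomCocycle.exists_ne_zero_transferOp_eq`).

*Reduction to a compact group.* Let `h_k` be a dense sequence in the space of `T`-fixed vectors. Its
sections `h_k(x, ·)` give an equivariant map from `X` to sequences in `L²(G)`. By ergodicity, almost
all its values lie in the closure of one orbit of translations; translations act properly away from
zero, so they lie in the orbit itself (`exists_isCompact_le_norm_smul_sub`,
`mem_orbit_of_mem_closure`). The orbit map has a measurable right inverse
(`exists_measurable_section`), which provides a measurable `P : X → G` that moves the sections to
a fixed sequence `w` (`RandomCocycle.exists_measurable_mk_smul_slice_eq`). Hence `P` conjugates the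
cocycle into the stabilizer `H` of `w`, which is compact, and may be assumed orthogonal
(`exists_conj_mem_orthogonalGroup`). By density of the `h_k`, every invariant function of the
conjugate cocycle is a function of `g` only, and it is `H`-invariant
(`RandomCocycle.exists_ae_eq_snd_of_transferOp_eq`).

*Stationary measures.* For a stationary measure `π` on `X × Z`, take `(x, z)` of law `π` and `g`
uniform in a compact neighbourhood `N` of `1` with `HN = N`. For `D ⊆ Z`, the law of `(x, g)` on the
event `g⁻¹ z ∈ D` is stationary on `X × G`, with bounded density. This density is therefore an
`H`-invariant function of `g`: the vector `g⁻¹ z` is independent of `x`, and its law is the same for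
`g` and `kg` with `k ∈ H` (`RandomCocycle.ae_measure_inv_smul_mem`). So `π = μ × ν` with `ν`
invariant under `H` (`RandomCocycle.IsStationary.exists_eq_prod`). Such a product is invariant,
because almost every `f_i` preserves `μ`: the shift being two-sided, the letter `i` can still be
read at the coordinate `-1` after one step, and is independent of `f_i(x)` there
(`RandomTransformation.ae_map_eq`).
-/


set_option linter.unusedSectionVars false

noncomputable section

/-! ### The averaging operator on `L²` -/

section AveragingOperator

open scoped RealInnerProductSpace ENNReal

variable {Y W : Type*} [MeasurableSpace Y] [MeasurableSpace W] {p : Measure Y}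
  [IsProbabilityMeasure p] {ν : Measure W} [SigmaFinite ν] {Φ : Y × W → W}

/-- The isometry `u ↦ u ∘ g` from `L²(ν)` to `L²(m)`, for `g` mapping `m` to `ν`. -/
def koopman {Z : Type*} [MeasurableSpace Z] {m : Measure Z} {g : Z → W}
    (hg : MeasurePreserving g m ν) : Lp ℝ 2 ν →ₗᵢ[ℝ] Lp ℝ 2 m :=
  Lp.compMeasurePreservingₗᵢ ℝ g hg

lemma coeFn_koopman {Z : Type*} [MeasurableSpace Z] {m : Measure Z} {g : Z → W}
    (hg : MeasurePreserving g m ν) (u : Lp ℝ 2 ν) : koopman hg u =ᵐ[m] fun z => u (g z) :=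
  Lp.coeFn_compMeasurePreserving u hg

/-- The operator `J* I` on `L²(ν)`, where `J u = u ∘ Φ` and `I u = u ∘ snd` are isometries from
`L²(ν)` to `L²(p × ν)`. It is the adjoint of `u ↦ ∫ u(Φ(i, ·)) dp(i)`, and sends the density of a
measure to the density of its average image under the maps `Φ(i, ·)`. -/
def transferOp (hΦ : MeasurePreserving Φ (p.prod ν) ν) : Lp ℝ 2 ν →L[ℝ] Lp ℝ 2 ν :=
  ContinuousLinearMap.adjoint (koopman hΦ).toContinuousLinearMap
    ∘L (koopman (measurePreserving_snd (μ := p) (ν := ν))).toContinuousLinearMap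

lemma inner_transferOp (hΦ : MeasurePreserving Φ (p.prod ν) ν) (u v : Lp ℝ 2 ν) :
    ⟪u, transferOp hΦ v⟫ =
      ⟪koopman hΦ u, koopman (measurePreserving_snd (μ := p) (ν := ν)) v⟫ := by
  unfold transferOp
  rw [ContinuousLinearMap.comp_apply, ContinuousLinearMap.adjoint_inner_right]
  rfl

lemma norm_transferOp_le (hΦ : MeasurePreserving Φ (p.prod ν) ν) : ‖transferOp hΦ‖ ≤ 1 := by
  refine (ContinuousLinearMap.opNorm_comp_le _ _).trans ?_
  rw [LinearIsometryEquiv.norm_map]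
  exact mul_le_one₀ (LinearIsometry.norm_toContinuousLinearMap_le _) (norm_nonneg _)
    (LinearIsometry.norm_toContinuousLinearMap_le _)

/-- Equality in the Cauchy-Schwarz inequality: a vector fixed by the averages is fixed by almost
every operator. -/
lemma koopman_eq_of_transferOp_eq (hΦ : MeasurePreserving Φ (p.prod ν) ν)
    {h : Lp ℝ 2 ν} (hh : transferOp hΦ h = h) :
    koopman hΦ h = koopman (measurePreserving_snd (μ := p) (ν := ν)) h := by
  have h1 := inner_transferOp hΦ h h
  rw [hh] at h1
  rw [← sub_eq_zero, ← norm_eq_zero, ← sq_eq_zero_iff, norm_sub_sq_real, ← h1,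
    LinearIsometry.norm_map, LinearIsometry.norm_map, real_inner_self_eq_norm_sq]
  ring

lemma transferOp_eq_self_iff (hΦ : MeasurePreserving Φ (p.prod ν) ν) {h : Lp ℝ 2 ν} :
    transferOp hΦ h = h ↔ ∀ᵐ q ∂(p.prod ν), h (Φ q) = h q.2 := by
  have e1 := coeFn_koopman hΦ h
  have e2 := coeFn_koopman (measurePreserving_snd (μ := p) (ν := ν)) h
  constructor
  · intro hh
    rw [koopman_eq_of_transferOp_eq hΦ hh] at e1
    exact e1.symm.trans e2
  · intro hh
    have h1 : koopman hΦ h = koopman (measurePreserving_snd (μ := p) (ν := ν)) h :=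
      Lp.ext ((e1.trans hh).trans e2.symm)
    refine ext_inner_left ℝ fun u => ?_
    rw [inner_transferOp, ← h1, LinearIsometry.inner_map_map]

/-- The average of the images of `η` under the maps `Φ(i, ·)`. -/
def averageImage (p : Measure Y) (Φ : Y × W → W) (η : Measure W) : Measure W :=
  (p.prod η).map Φ

lemma averageImage_le (hΦ : MeasurePreserving Φ (p.prod ν) ν) {η : Measure W} [SFinite η]
    (hη : η ≤ ν) : averageImage p Φ η ≤ ν := by
  conv_rhs => rw [← hΦ.map_eq]
  exact Measure.map_mono (Measure.prod_mono le_rfl hη) hΦ.measurable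

instance {η : Measure W} [IsFiniteMeasure η] : IsFiniteMeasure (averageImage p Φ η) := by
  unfold averageImage; infer_instance

lemma memLp_rnDeriv_of_le {η : Measure W} [IsFiniteMeasure η] (hη : η ≤ ν) :
    MemLp (fun w => (η.rnDeriv ν w).toReal) 2 ν := by
  have h1 : AEStronglyMeasurable (fun w => (η.rnDeriv ν w).toReal) ν :=
    (Measure.measurable_rnDeriv η ν).ennreal_toReal.aestronglyMeasurable
  rw [memLp_two_iff_integrable_sq h1]
  refine (Measure.integrable_toReal_rnDeriv (μ := η) (ν := ν)).mono' (h1.pow 2) ?_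
  filter_upwards [Measure.rnDeriv_le_one_of_le hη] with w hw
  have h2 : (η.rnDeriv ν w).toReal ≤ 1 := ENNReal.toReal_mono ENNReal.one_ne_top hw
  rw [Real.norm_of_nonneg (sq_nonneg _), sq]
  exact mul_le_of_le_one_left ENNReal.toReal_nonneg h2

/-- The density of a finite measure `η ≤ ν`, as an element of `L²(ν)`. -/
def densityOfLe {η : Measure W} [IsFiniteMeasure η] (hη : η ≤ ν) : Lp ℝ 2 ν :=
  (memLp_rnDeriv_of_le hη).toLp

lemma inner_densityOfLe {η : Measure W} [IsFiniteMeasure η] (hη : η ≤ ν) (u : Lp ℝ 2 ν) :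
    ⟪u, densityOfLe hη⟫ = ∫ w, u w ∂η := by
  rw [L2.inner_def, ← integral_rnDeriv_smul (Measure.absolutelyContinuous_of_le hη)]
  refine integral_congr_ae ?_
  filter_upwards [(memLp_rnDeriv_of_le hη).coeFn_toLp] with w hw
  change ⟪u w, (memLp_rnDeriv_of_le hη).toLp _ w⟫ = _
  rw [hw]
  simp

lemma transferOp_densityOfLe (hΦ : MeasurePreserving Φ (p.prod ν) ν) {η : Measure W}
    [IsFiniteMeasure η] (hη : η ≤ ν) :
    transferOp hΦ (densityOfLe hη) = densityOfLe (averageImage_le hΦ hη) := by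
  refine ext_inner_left ℝ fun u => ?_
  rw [inner_transferOp, inner_densityOfLe, L2.inner_def, averageImage,
    integral_map hΦ.measurable.aemeasurable (Lp.stronglyMeasurable u).aestronglyMeasurable]
  have h1 : p.prod η = (p.prod ν).withDensity fun q => η.rnDeriv ν q.2 := by
    conv_lhs => rw [← Measure.withDensity_rnDeriv_eq _ _ (Measure.absolutelyContinuous_of_le hη)]
    exact prod_withDensity_right (Measure.measurable_rnDeriv _ _)
  have hsnd := measurePreserving_snd (μ := p) (ν := ν)
  rw [h1, integral_withDensity_eq_integral_toReal_smul (f := fun q : Y × W => η.rnDeriv ν q.2)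
    ((Measure.measurable_rnDeriv _ _).comp measurable_snd)
    (hsnd.quasiMeasurePreserving.ae (Measure.rnDeriv_lt_top η ν))]
  refine integral_congr_ae ?_
  filter_upwards [coeFn_koopman hΦ u, coeFn_koopman hsnd (densityOfLe hη),
    hsnd.quasiMeasurePreserving.ae (memLp_rnDeriv_of_le hη).coeFn_toLp] with q h1 h2 h3
  rw [h1, h2, densityOfLe, h3]
  simp

end AveragingOperator

/-! ### Independent steps -/

section BernoulliShift

open ProbabilityTheory

variable {Y W : Type*} [MeasurableSpace Y] [MeasurableSpace W] (p : Measure Y)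
  [IsProbabilityMeasure p]

lemma infinitePi_map_comp_injective {ι κ : Type*} {e : ι → κ} (he : Function.Injective e) :
    (Measure.infinitePi fun _ : κ => p).map (fun ω i => ω (e i)) =
      Measure.infinitePi fun _ : ι => p := by
  have h := (iIndepFun_infinitePi (P := fun _ : κ => p) (X := fun _ y => y)
    (fun _ => measurable_id)).precomp he
  have h2 := iIndepFun.map_fun_eq_infinitePi_map (fun i => measurable_pi_apply (e i)) h
  refine h2.trans ?_
  congr 1
  funext i
  exact Measure.infinitePi_map_eval (fun _ : κ => p) (e i)

/-- The first letter of an i.i.d. sequence is independent of the shifted sequence. -/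
lemma infinitePi_map_head_tail :
    (Measure.infinitePi fun _ : ℕ => p).map (fun ω => (ω 0, fun n => ω (n + 1))) =
      p.prod (Measure.infinitePi fun _ : ℕ => p) := by
  let c : Y × (ℕ → Y) → ℕ → Y := fun q n => Nat.casesOn n q.1 q.2
  have hc : Measurable c := by
    refine measurable_pi_lambda _ fun n => ?_
    cases n with
    | zero => exact measurable_fst
    | succ k => exact (measurable_pi_apply k).comp measurable_snd
  have key : (p.prod (Measure.infinitePi fun _ : ℕ => p)).map c =
      Measure.infinitePi fun _ : ℕ => p := by
    refine Measure.eq_infinitePi _ fun s t ht => ?_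
    classical
    obtain ⟨N, hN⟩ : ∃ N, s ⊆ Finset.range (N + 1) :=
      ⟨s.sup id, fun i hi => Finset.mem_range.2 (Nat.lt_succ_of_le (Finset.le_sup (f := id) hi))⟩
    -- the box is rewritten as a box over an initial segment of `ℕ`
    let t' : ℕ → Set Y := fun i => if i ∈ s then t i else Set.univ
    have ht' : ∀ i, MeasurableSet (t' i) := fun i => by
      by_cases hi : i ∈ s <;> simp [t', hi, ht]
    have h1 : c ⁻¹' (Set.pi s t) = t' 0 ×ˢ Set.pi (Finset.range N) (fun i => t' (i + 1)) := by
      ext q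
      simp only [Set.mem_preimage, Set.mem_pi, Finset.mem_coe, Set.mem_prod, Finset.mem_range]
      constructor
      · intro h
        refine ⟨?_, fun i _ => ?_⟩
        · by_cases h0 : 0 ∈ s
          · have h2 : q.1 ∈ t 0 := h 0 h0
            simpa [t', h0] using h2
          · simp [t', h0]
        · by_cases h0 : i + 1 ∈ s
          · simpa [t', h0] using h (i + 1) h0
          · simp [t', h0]
      · rintro ⟨h0, h1⟩ i hi
        cases i with
        | zero =>
          change q.1 ∈ t 0
          simpa [t', hi] using h0
        | succ k => simpa [t', hi] using h1 k (by have := Finset.mem_range.1 (hN hi); omega)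
    rw [Measure.map_apply hc (.pi s.countable_toSet fun i _ => ht i), h1, Measure.prod_prod,
      Measure.infinitePi_pi _ fun i _ => ht' _, mul_comm,
      ← Finset.prod_range_succ' (fun i => p (t' i)) N]
    rw [← Finset.prod_subset hN (fun i _ hi => by simp [t', hi])]
    exact Finset.prod_congr rfl fun i hi => by simp [t', hi]
  have hm : Measurable fun ω : ℕ → Y => (ω 0, fun n => ω (n + 1)) := by fun_prop
  conv_lhs => rw [← key, Measure.map_map hm hc]
  exact Measure.map_id

variable {p} (Φ : Y × W → W)

/-- The one-sided skew product `(ω, w) ↦ (θ ω, Φ(ω₀, w))`. -/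
def skewProduct (q : (ℕ → Y) × W) : (ℕ → Y) × W :=
  (fun n => q.1 (n + 1), Φ (q.1 0, q.2))

variable {Φ}

lemma measurable_skewProduct (hΦ : Measurable Φ) : Measurable (skewProduct Φ) := by
  unfold skewProduct; fun_prop

lemma map_skewProduct (hΦ : Measurable Φ) (η : Measure W) [IsFiniteMeasure η] :
    ((Measure.infinitePi fun _ : ℕ => p).prod η).map (skewProduct Φ) =
      (Measure.infinitePi fun _ : ℕ => p).prod (averageImage p Φ η) := by
  have e1 : skewProduct Φ = (Prod.map id Φ) ∘
      (fun q : (Y × (ℕ → Y)) × W => (q.1.2, (q.1.1, q.2))) ∘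
      (Prod.map (fun ω : ℕ → Y => (ω 0, fun n => ω (n + 1))) id) := rfl
  have hm : Measurable fun ω : ℕ → Y => (ω 0, fun n => ω (n + 1)) := by fun_prop
  rw [e1, ← Measure.map_map (by fun_prop) (by fun_prop),
    ← Measure.map_map (by fun_prop) (by fun_prop), ← Measure.map_prod_map _ _ hm measurable_id,
    infinitePi_map_head_tail, Measure.map_id]
  have h2 : ((p.prod (Measure.infinitePi fun _ : ℕ => p)).prod η).map
      (fun q : (Y × (ℕ → Y)) × W => (q.1.2, (q.1.1, q.2))) =
      (Measure.infinitePi fun _ : ℕ => p).prod (p.prod η) := by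
    have e2 : (fun q : (Y × (ℕ → Y)) × W => (q.1.2, (q.1.1, q.2))) =
      (MeasurableEquiv.prodAssoc : ((ℕ → Y) × Y) × W ≃ᵐ _) ∘ Prod.map Prod.swap id := rfl
    rw [e2, ← Measure.map_map (by fun_prop) (by fun_prop),
      ← Measure.map_prod_map _ _ measurable_swap measurable_id, Measure.prod_swap, Measure.map_id]
    exact (measurePreserving_prodAssoc _ _ _).map_eq
  rw [h2, ← Measure.map_prod_map _ _ measurable_id hΦ, Measure.map_id, averageImage]

/-- The successive points of the random orbit of an `η`-distributed initial point, with independent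
steps of law `p`, have the laws obtained by iterating `averageImage`. -/
lemma map_skewProduct_iterate (hΦ : Measurable Φ) (n : ℕ) (η : Measure W) [IsFiniteMeasure η] :
    ((Measure.infinitePi fun _ : ℕ => p).prod η).map (fun q => ((skewProduct Φ)^[n] q).2) =
      (averageImage p Φ)^[n] η := by
  induction n generalizing η with
  | zero => simp
  | succ n ih =>
    have e : (fun q => ((skewProduct Φ)^[n + 1] q).2) =
        (fun q => ((skewProduct Φ)^[n] q).2) ∘ skewProduct Φ := by
      funext q; simp
    have hm := measurable_skewProduct (Y := Y) hΦ
    have hn : Measurable fun q => ((skewProduct Φ)^[n] q).2 := measurable_snd.comp (hm.iterate n)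
    rw [e, ← Measure.map_map hn hm, map_skewProduct hΦ, ih]
    rfl

end BernoulliShift

/-! ### Random transformations -/

lemma exists_countable_isPiSystem_generateFrom (α : Type*) [m : MeasurableSpace α]
    [MeasurableSpace.CountablyGenerated α] :
    ∃ C : Set (Set α), C.Countable ∧ IsPiSystem C ∧ Set.univ ∈ C ∧
      MeasurableSpace.generateFrom C = m := by
  refine ⟨generateSetAlgebra (MeasurableSpace.countableGeneratingSet α),
    countable_generateSetAlgebra MeasurableSpace.countable_countableGeneratingSet,
    fun s hs t ht _ => isSetAlgebra_generateSetAlgebra.inter_mem hs ht,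
    isSetAlgebra_generateSetAlgebra.univ_mem, ?_⟩
  rw [generateFrom_generateSetAlgebra_eq, MeasurableSpace.generateFrom_countableGeneratingSet]

namespace RandomTransformation

variable {Y X : Type*} [MeasurableSpace Y] [MeasurableSpace X] {p : Measure Y}
  [IsProbabilityMeasure p] {μ : Measure X} [IsProbabilityMeasure μ] (f : RandomTransformation p μ)

instance : IsProbabilityMeasure (skewMeasure p μ) := by
  unfold skewMeasure; infer_instance

variable (p μ) in
lemma measurePreserving_coord (k : ℤ) :
    MeasurePreserving (fun z : (ℤ → Y) × X => (z.1 k, z.2)) (skewMeasure p μ) (p.prod μ) :=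
  (measurePreserving_eval_infinitePi (fun _ : ℤ => p) k).prod (MeasurePreserving.id μ)

lemma measurable_map : Measurable fun q : Y × X => f.map q.1 q.2 := by
  have h : Measurable fun q : Y × X => ((fun _ => q.1, q.2) : (ℤ → Y) × X) := by fun_prop
  exact measurable_snd.comp (f.ergodic.measurable.comp h)

/-- Invariance of `p^ℤ × μ` under the two-sided shift says that `f_i(x)` is independent of the
letter `i`, which the shift moves to the coordinate `-1`. -/
lemma measurePreserving_letter_map :
    MeasurePreserving (fun q : Y × X => (q.1, f.map q.1 q.2)) (p.prod μ) (p.prod μ) := by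
  have hm : Measurable fun q : Y × X => (q.1, f.map q.1 q.2) :=
    measurable_fst.prodMk f.measurable_map
  refine ⟨hm, ?_⟩
  have h0 := measurePreserving_coord p μ 0
  have h1 := (measurePreserving_coord p μ (-1)).comp f.ergodic.toMeasurePreserving
  rw [← h0.map_eq, Measure.map_map hm h0.measurable, h0.map_eq, ← h1.map_eq]
  rfl

lemma measurePreserving_map :
    MeasurePreserving (fun q : Y × X => f.map q.1 q.2) (p.prod μ) μ :=
  measurePreserving_snd.comp f.measurePreserving_letter_map

/-- By independence of `i` and `f_i(x)`, the function `i ↦ μ(f_i⁻¹(D))` has integral `p(C) μ(D)`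
over every set `C`, hence is almost everywhere equal to `μ(D)`. -/
lemma ae_map_eq [MeasurableSpace.CountablyGenerated X] : ∀ᵐ i ∂p, μ.map (f.map i) = μ := by
  have hmi : ∀ i, Measurable (f.map i) := fun i => f.measurable_map.comp measurable_prodMk_left
  have key : ∀ D : Set X, MeasurableSet D → ∀ᵐ i ∂p, μ (f.map i ⁻¹' D) = μ D := by
    intro D hD
    have hm : Measurable fun i => μ (f.map i ⁻¹' D) :=
      measurable_measure_prodMk_left (f.measurable_map hD)
    refine ae_eq_of_forall_setLIntegral_eq_of_sigmaFinite hm measurable_const fun C hC _ => ?_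
    have h1 := f.measurePreserving_letter_map.measure_preimage (hC.prod hD).nullMeasurableSet
    rw [Measure.prod_prod, Measure.prod_apply
      (f.measurePreserving_letter_map.measurable (hC.prod hD))] at h1
    rw [setLIntegral_const, mul_comm, ← h1, ← lintegral_indicator hC]
    refine lintegral_congr fun i => ?_
    by_cases hi : i ∈ C
    · rw [Set.indicator_of_mem hi]
      congr 1
      ext x
      simp [hi]
    · rw [Set.indicator_of_notMem hi]
      symm
      convert measure_empty (μ := μ)
      ext x
      simp [hi]
  obtain ⟨C, hC, hpi, -, hgen⟩ := exists_countable_isPiSystem_generateFrom X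
  have h2 : ∀ᵐ i ∂p, ∀ D ∈ C, μ (f.map i ⁻¹' D) = μ D :=
    (ae_ball_iff hC).2 fun D hD => key D (hgen ▸ MeasurableSpace.measurableSet_generateFrom hD)
  filter_upwards [h2] with i hi
  have : IsProbabilityMeasure (μ.map (f.map i)) :=
    Measure.isProbabilityMeasure_map (hmi i).aemeasurable
  refine ext_of_generate_finite C hgen.symm hpi (fun D hD => ?_) (by simp)
  rw [Measure.map_apply (hmi i) (hgen ▸ MeasurableSpace.measurableSet_generateFrom hD), hi D hD]

/-- A measurable set which is invariant under almost every `f_i`, up to null sets, is null or of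
full measure. -/
lemma ae_mem_or_ae_notMem {D : Set X} (hD : MeasurableSet D)
    (h : ∀ᵐ q ∂(p.prod μ), f.map q.1 q.2 ∈ D ↔ q.2 ∈ D) :
    (∀ᵐ x ∂μ, x ∈ D) ∨ ∀ᵐ x ∂μ, x ∉ D := by
  have hs := measurePreserving_coord p μ 0
  have hsnd : MeasurePreserving (Prod.snd : (ℤ → Y) × X → X) (skewMeasure p μ) μ :=
    measurePreserving_snd
  have h1 : skewShift f.map ⁻¹' (Prod.snd ⁻¹' D) =ᵐ[skewMeasure p μ] Prod.snd ⁻¹' D := by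
    filter_upwards [hs.quasiMeasurePreserving.ae h] with z hz
    exact propext hz
  rcases f.ergodic.quasiErgodic.ae_mem_or_ae_notMem₀ (hsnd.measurable hD).nullMeasurableSet h1
    with h2 | h2
  · left
    rw [← hsnd.map_eq]
    exact (ae_map_iff hsnd.measurable.aemeasurable hD).2 h2
  · right
    rw [← hsnd.map_eq]
    exact (ae_map_iff hsnd.measurable.aemeasurable hD.compl).2 h2

end RandomTransformation

/-! ### A nonzero invariant function on `X × G` -/

/-- If the visits of the points of a set of positive measure to the sets `D n` have lower density
bounded below, then the measures of the sets `D n` do not tend to zero in mean. -/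
lemma not_tendsto_average_measureReal {Z : Type*} [MeasurableSpace Z] {P : Measure Z}
    [IsProbabilityMeasure P] {D : ℕ → Set Z} (hD : ∀ n, MeasurableSet (D n)) {E : Set Z}
    (hE : 0 < P E) {δ : ℝ} (hδ : 0 < δ)
    (h : ∀ z ∈ E, δ ≤ RandomCocycle.lowerDensity {n : ℕ | z ∈ D n}) :
    ¬ Tendsto (fun n : ℕ => (n : ℝ)⁻¹ * ∑ m ∈ Finset.range n, P.real (D m)) atTop (𝓝 0) := by
  intro hlim
  -- `lowerDensity` counts the `n + 1` times `0, …, n` but divides by `n`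
  let g : ℕ → Z → ℝ := fun n z =>
    (∑ m ∈ Finset.range (n + 1), (D m).indicator (fun _ => (1 : ℝ)) z) / n
  have hg : ∀ n z, ((Set.Icc 0 n ∩ {m : ℕ | z ∈ D m}).ncard : ℝ) / (n : ℝ) = g n z := by
    intro n z
    classical
    have : Set.Icc 0 n ∩ {m : ℕ | z ∈ D m} = ↑((Finset.range (n + 1)).filter fun m => z ∈ D m) := by
      ext m
      simp
    rw [this, Set.ncard_coe_finset, Finset.card_filter]
    simp [g, Set.indicator_apply]
  have hg0 : ∀ n z, 0 ≤ g n z := fun n z =>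
    div_nonneg (Finset.sum_nonneg fun m _ => Set.indicator_nonneg (fun _ _ => zero_le_one) z)
      n.cast_nonneg
  have hint : ∀ m, Integrable ((D m).indicator (fun _ => (1 : ℝ))) P := fun m =>
    (integrable_const 1).indicator (hD m)
  have hgm : ∀ n, Measurable (g n) := fun n =>
    (Finset.measurable_sum _ fun m _ => measurable_const.indicator (hD m)).div_const _
  have hgi : ∀ n, ∫ z, g n z ∂P = (∑ m ∈ Finset.range (n + 1), P.real (D m)) / n := by
    intro n
    simp only [g]
    rw [integral_div, integral_finsetSum _ fun m _ => hint m]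
    congr 1
    exact Finset.sum_congr rfl fun m _ => by rw [integral_indicator_const _ (hD m)]; simp
  have hlim2 : Tendsto (fun n : ℕ => (∑ m ∈ Finset.range (n + 1), P.real (D m)) / (n : ℝ))
      atTop (𝓝 0) := by
    have h1 := (hlim.comp (tendsto_add_atTop_nat 1)).mul
      ((tendsto_natCast_div_add_atTop (1 : ℝ)).inv₀ one_ne_zero)
    rw [zero_mul] at h1
    refine h1.congr' ?_
    filter_upwards [eventually_gt_atTop 0] with n hn
    have : (n : ℝ) ≠ 0 := by positivity
    simp only [Function.comp_apply, Nat.cast_add, Nat.cast_one]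
    field_simp
  have hlim3 : Tendsto (fun n => ∫⁻ z, ENNReal.ofReal (g n z) ∂P) atTop (𝓝 0) := by
    have h1 := ENNReal.tendsto_ofReal hlim2
    rw [ENNReal.ofReal_zero] at h1
    refine h1.congr fun n => ?_
    rw [← hgi, ofReal_integral_eq_lintegral_ofReal _ (ae_of_all _ (hg0 n))]
    exact (integrable_finsetSum _ fun m _ => hint m).div_const _
  -- by Fatou's lemma, the visits have lower density zero almost everywhere
  have hfatou := lintegral_liminf_le (μ := P) (u := atTop) (f := fun n z => ENNReal.ofReal (g n z))
    fun n => (hgm n).ennreal_ofReal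
  rw [hlim3.liminf_eq, nonpos_iff_eq_zero, lintegral_eq_zero_iff
    (.liminf fun n => (hgm n).ennreal_ofReal)] at hfatou
  have hnull : P E = 0 := by
    refine measure_mono_null (fun z hz => ?_) hfatou
    have h1 : δ / 2 < liminf (fun n : ℕ =>
        ((Set.Icc 0 n ∩ {m : ℕ | z ∈ D m}).ncard : ℝ) / (n : ℝ)) atTop :=
      (half_lt_self hδ).trans_le (h z hz)
    have h2 := eventually_lt_of_lt_liminf h1
      ⟨0, eventually_map.2 (Eventually.of_forall fun n => by rw [hg]; exact hg0 n z)⟩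
    have h3 : ENNReal.ofReal (δ / 2) ≤ liminf (fun n => ENNReal.ofReal (g n z)) atTop :=
      le_liminf_of_le (by isBoundedDefault) (h2.mono fun n hn => by
        rw [hg] at hn; exact ENNReal.ofReal_le_ofReal hn.le)
    have h4 : 0 < ENNReal.ofReal (δ / 2) := ENNReal.ofReal_pos.2 (half_pos hδ)
    exact (h4.trans_le h3).ne'
  exact hE.ne' hnull

namespace RandomCocycle

open scoped Pointwise RealInnerProductSpace

variable {Y X : Type*} [MeasurableSpace Y] [MeasurableSpace X] {p : Measure Y}
  [IsProbabilityMeasure p] {μ : Measure X} [IsProbabilityMeasure μ] {f : RandomTransformation p μ}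
  {G : Type*} [Group G] [TopologicalSpace G] [IsTopologicalGroup G] [LocallyCompactSpace G]
  [SecondCountableTopology G] [T2Space G] [MeasurableSpace G] [BorelSpace G]

/-- The skew product `(i, (x, g)) ↦ (f_i(x), A_i(x) g)` on `X × G`. -/
def groupStep (A : RandomCocycle f G) (q : Y × (X × G)) : X × G :=
  (f.map q.1 q.2.1, A.map q.1 q.2.1 * q.2.2)

lemma measurePreserving_groupStep (A : RandomCocycle f G) :
    MeasurePreserving A.groupStep (p.prod (μ.prod Measure.haar)) (μ.prod Measure.haar) := by
  have h1 : Measurable (Function.uncurry fun (q : Y × X) (g : G) => A.map q.1 q.2 * g) :=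
    (A.measurable.comp measurable_fst).mul measurable_snd
  have h2 := f.measurePreserving_map.skew_product (μc := Measure.haar) (μd := Measure.haar) h1
    (ae_of_all _ fun q => map_mul_left_eq_self Measure.haar (A.map q.1 q.2))
  exact h2.comp (measurePreserving_prodAssoc p μ Measure.haar).symm

lemma measurable_iter (A : RandomCocycle f G) (n : ℕ) : Measurable (A.iter n) := by
  have he : Measurable A.eval := by
    have h : Measurable fun z : (ℤ → Y) × X => (z.1 0, z.2) := by fun_prop
    exact A.measurable.comp h
  induction n with
  | zero => exact measurable_const
  | succ n ih => exact (he.comp (f.ergodic.measurable.iterate n)).mul ih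

lemma skewProduct_groupStep_iterate (A : RandomCocycle f G) (n : ℕ) (ω : ℤ → Y) (x : X) (g : G) :
    (skewProduct A.groupStep)^[n] (fun k : ℕ => ω k, (x, g)) =
      (fun k : ℕ => ((skewShift f.map)^[n] (ω, x)).1 k,
        (((skewShift f.map)^[n] (ω, x)).2, A.iter n (ω, x) * g)) := by
  induction n with
  | zero => simp [iter]
  | succ n ih =>
    rw [Function.iterate_succ_apply', ih, Function.iterate_succ_apply']
    simp [skewProduct, groupStep, skewShift, iter, eval, mul_assoc]

/-- Starting from the normalization `μ × haar|U`, the mass of `X × KU` at time `n` is at least the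
probability that the cocycle is in `K` times the mass of `U`. -/
lemma measure_iter_mul_le (A : RandomCocycle f G) {K U : Set G} (hK : IsCompact K)
    (hU : IsCompact U) (n : ℕ) :
    skewMeasure p μ (A.iter n ⁻¹' K) * Measure.haar U ≤
      ((averageImage p A.groupStep)^[n] (μ.prod (Measure.haar.restrict U)))
        (Set.univ ×ˢ (K * U)) := by
  have : IsFiniteMeasure ((Measure.haar : Measure G).restrict U) :=
    ⟨by simpa using hU.measure_lt_top⟩
  have hKU : MeasurableSet (Set.univ ×ˢ (K * U) : Set (X × G)) :=
    MeasurableSet.univ.prod (hK.mul hU).measurableSet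
  have hs := A.measurePreserving_groupStep.measurable
  have hm : Measurable fun q => ((skewProduct A.groupStep)^[n] q).2 :=
    measurable_snd.comp ((measurable_skewProduct hs).iterate n)
  have hr : Measurable fun ω : ℤ → Y => fun k : ℕ => ω k := by fun_prop
  rw [← map_skewProduct_iterate hs, Measure.map_apply hm hKU,
    ← infinitePi_map_comp_injective p (e := fun k : ℕ => (k : ℤ)) Nat.cast_injective]
  conv_rhs => rw [← Measure.map_id (μ := μ.prod (Measure.haar.restrict U))]
  rw [Measure.map_prod_map _ _ hr measurable_id,
    Measure.map_apply (hr.prodMap measurable_id) (hm hKU)]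
  rw [← (measurePreserving_prodAssoc (Measure.infinitePi fun _ : ℤ => p) μ
    (Measure.haar.restrict U)).map_eq, Measure.map_apply (by fun_prop)
      ((hr.prodMap measurable_id) (hm hKU))]
  have h1 : skewMeasure p μ (A.iter n ⁻¹' K) * Measure.haar U =
      ((Measure.infinitePi fun _ : ℤ => p).prod μ).prod (Measure.haar.restrict U)
        ((A.iter n ⁻¹' K) ×ˢ U) := by
    rw [Measure.prod_prod, Measure.restrict_apply_self]
    rfl
  rw [h1]
  refine measure_mono ?_
  rintro ⟨⟨ω, x⟩, g⟩ ⟨h2, h3⟩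
  have h4 := A.skewProduct_groupStep_iterate n ω x g
  simp only [Set.mem_preimage, MeasurableEquiv.prodAssoc, MeasurableEquiv.coe_mk,
    Equiv.prodAssoc_apply, Prod.map_apply, id]
  rw [h4]
  exact ⟨trivial, Set.mul_mem_mul h2 h3⟩

/-- The orbit of a density under the transfer operator consists of the densities of the iterated
average images. -/
lemma inner_transferOp_iterate_densityOfLe {W : Type*} [MeasurableSpace W] {ν : Measure W}
    [SigmaFinite ν] {Φ : Y × W → W} (hΦ : MeasurePreserving Φ (p.prod ν) ν) {D : Set W}
    (hD : MeasurableSet D) (hνD : ν D ≠ ⊤) (n : ℕ) {η : Measure W} [IsFiniteMeasure η]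
    (hη : η ≤ ν) :
    ⟪indicatorConstLp 2 hD hνD (1 : ℝ), (transferOp hΦ)^[n] (densityOfLe hη)⟫ =
      ((averageImage p Φ)^[n] η).real D := by
  induction n generalizing η with
  | zero =>
    rw [Function.iterate_zero, id, inner_densityOfLe, Function.iterate_zero, id]
    have h1 := (Measure.absolutelyContinuous_of_le hη).ae_le
      (indicatorConstLp_coeFn (p := 2) (hs := hD) (hμs := hνD) (c := (1 : ℝ)))
    rw [integral_congr_ae h1, integral_indicator_const _ hD]
    simp
  | succ n ih =>
    rw [Function.iterate_succ_apply, transferOp_densityOfLe, ih, Function.iterate_succ_apply]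

/-- An essentially bounded cocycle has a nonzero invariant square integrable function on `X × G`:
by the mean ergodic theorem, it is the limit in mean of the densities of the random orbits that
start uniformly in a compact neighbourhood of the identity. -/
theorem exists_ne_zero_transferOp_eq (A : RandomCocycle f G) (hA : A.EssentiallyBounded) :
    ∃ h : Lp ℝ 2 (μ.prod (Measure.haar : Measure G)), h ≠ 0 ∧
      transferOp A.measurePreserving_groupStep h = h := by
  obtain ⟨K, δ, E, hK, hδ, hE, hE0, hdens⟩ := hA
  obtain ⟨U, hU, hU1⟩ := exists_compact_mem_nhds (1 : G)
  have hUpos : 0 < (Measure.haar : Measure G).real U :=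
    ENNReal.toReal_pos (Measure.measure_pos_of_mem_nhds _ hU1).ne' hU.measure_lt_top.ne
  have : IsFiniteMeasure ((Measure.haar : Measure G).restrict U) :=
    ⟨by simpa using hU.measure_lt_top⟩
  have hη : μ.prod ((Measure.haar : Measure G).restrict U) ≤ μ.prod Measure.haar :=
    Measure.prod_mono le_rfl Measure.restrict_le_self
  have hD : MeasurableSet (Set.univ ×ˢ (K * U) : Set (X × G)) :=
    MeasurableSet.univ.prod (hK.mul hU).measurableSet
  have hD1 : μ.prod Measure.haar (Set.univ ×ˢ (K * U) : Set (X × G)) ≠ ⊤ := by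
    rw [Measure.prod_prod, measure_univ, one_mul]
    exact (hK.mul hU).measure_lt_top.ne
  set T := transferOp A.measurePreserving_groupStep with hT
  obtain ⟨h, hfix, hlim⟩ : ∃ h, T h = h ∧
      Tendsto (birkhoffAverage ℝ T _root_.id · (densityOfLe hη)) atTop (𝓝 h) :=
    ⟨_, LinearMap.mem_eqLocus.1 (SetLike.coe_mem _), T.tendsto_birkhoffAverage_orthogonalProjection
      (norm_transferOp_le A.measurePreserving_groupStep) (densityOfLe hη)⟩
  refine ⟨h, fun h0 => ?_, hfix⟩
  rw [h0] at hlim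
  have hlim2 := ((innerSL ℝ (indicatorConstLp 2 hD hD1 (1 : ℝ))).continuous.tendsto _).comp hlim
  rw [map_zero] at hlim2
  have hmeas : ∀ n, MeasurableSet (A.iter n ⁻¹' K) := fun n =>
    A.measurable_iter n hK.measurableSet
  refine not_tendsto_average_measureReal (P := skewMeasure p μ) hmeas hE0 hδ hdens ?_
  have hlim3 := hlim2.mul_const ((Measure.haar : Measure G).real U)⁻¹
  rw [zero_mul] at hlim3
  refine squeeze_zero (fun n => by positivity) (fun n => ?_) hlim3
  have h1 : ∀ m, (skewMeasure p μ).real (A.iter m ⁻¹' K) * (Measure.haar : Measure G).real U ≤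
      ⟪indicatorConstLp 2 hD hD1 (1 : ℝ), T^[m] (densityOfLe hη)⟫ := by
    intro m
    have hfin : ∀ m, IsFiniteMeasure ((averageImage p A.groupStep)^[m]
        (μ.prod ((Measure.haar : Measure G).restrict U))) := by
      intro m
      induction m with
      | zero => simp only [Function.iterate_zero, id]; infer_instance
      | succ m ih => rw [Function.iterate_succ_apply']; infer_instance
    have := hfin m
    rw [inner_transferOp_iterate_densityOfLe]
    have h2 := ENNReal.toReal_mono (measure_ne_top _ _) (A.measure_iter_mul_le hK hU m)
    rwa [ENNReal.toReal_mul] at h2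
  simp only [Function.comp_apply, birkhoffAverage, birkhoffSum, id, map_smul, map_sum,
    smul_eq_mul, innerSL_apply_apply]
  rw [mul_assoc]
  refine mul_le_mul_of_nonneg_left ?_ (by positivity)
  rw [Finset.sum_mul]
  refine Finset.sum_le_sum fun m _ => ?_
  rw [← div_eq_mul_inv, le_div_iff₀ hUpos]
  exact h1 m

end RandomCocycle

/-! ### Translations of square integrable functions -/

section Translations

open scoped Pointwise RealInnerProductSpace ENNReal
open DomMulAct

variable {G : Type*} [Group G] [TopologicalSpace G] [IsTopologicalGroup G] [LocallyCompactSpace G]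
  [SecondCountableTopology G] [T2Space G] [MeasurableSpace G] [BorelSpace G]

instance : Fact ((2 : ℝ≥0∞) ≠ ∞) := ⟨by simp⟩

/-- The translates of a square integrable function leave a neighbourhood of any nonzero vector when
the translation goes to infinity: this is clear for compactly supported functions, whose translates
become orthogonal to any other one. -/
lemma exists_isCompact_le_norm_smul_sub (φ ψ : Lp ℝ 2 (Measure.haar : Measure G)) (hψ : ψ ≠ 0) :
    ∃ C : Set G, IsCompact C ∧ ∀ g ∉ C, ‖ψ‖ / 2 ≤ ‖mk g • φ - ψ‖ := by
  have hpos : 0 < ‖ψ‖ / 6 := by have := norm_pos_iff.2 hψ; positivity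
  have happrox : ∀ u : Lp ℝ 2 (Measure.haar : Measure G), ∃ (v : G → ℝ) (hv : MemLp v 2
      Measure.haar), HasCompactSupport v ∧ ‖u - hv.toLp‖ ≤ ‖ψ‖ / 6 := by
    intro u
    obtain ⟨v, hv1, hv2, -, hv4⟩ := (Lp.memLp u).exists_hasCompactSupport_eLpNorm_sub_le
      (by simp) (ENNReal.ofReal_pos.2 hpos).ne'
    refine ⟨v, hv4, hv1, ?_⟩
    rw [← dist_eq_norm, ← ENNReal.ofReal_le_ofReal_iff hpos.le, ← Lp.edist_dist]
    conv_lhs => rw [← Lp.toLp_coeFn u (Lp.memLp u)]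
    rw [Lp.edist_toLp_toLp]
    exact hv2
  obtain ⟨a, ha, hac, hau⟩ := happrox φ
  obtain ⟨b, hb, hbc, hbu⟩ := happrox ψ
  refine ⟨tsupport a * (tsupport b)⁻¹, hac.isCompact.mul hbc.isCompact.inv, fun g hg => ?_⟩
  have horth : ⟪mk g • ha.toLp, hb.toLp⟫ = 0 := by
    rw [L2.inner_def]
    refine integral_eq_zero_of_ae ?_
    have h1 := smul_Lp_ae_eq (mk g) ha.toLp
    have h2 := (measurePreserving_smul g (Measure.haar : Measure G)).quasiMeasurePreserving.ae
      ha.coeFn_toLp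
    filter_upwards [h1, h2, hb.coeFn_toLp] with x h1 h2 h3
    rw [h1, h3, Equiv.symm_apply_apply, h2, smul_eq_mul, Pi.zero_apply]
    by_cases hx : x ∈ tsupport b
    · have : g * x ∉ tsupport a := fun h => hg ⟨g * x, h, x⁻¹, Set.inv_mem_inv.2 hx, by simp⟩
      rw [image_eq_zero_of_notMem_tsupport this, inner_zero_left]
    · rw [image_eq_zero_of_notMem_tsupport hx, inner_zero_right]
  have h1 : ‖hb.toLp‖ ≤ ‖mk g • ha.toLp - hb.toLp‖ := by
    refine le_of_sq_le_sq ?_ (norm_nonneg _)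
    rw [norm_sub_sq_real, horth]
    nlinarith [sq_nonneg ‖mk g • ha.toLp‖]
  have h2 : ‖mk g • φ - mk g • ha.toLp‖ ≤ ‖ψ‖ / 6 := by
    rw [← smul_Lp_sub, norm_smul_Lp]; exact hau
  have h3 : ‖ψ‖ ≤ ‖ψ - hb.toLp‖ + ‖hb.toLp‖ := by
    simpa using norm_add_le (ψ - hb.toLp) hb.toLp
  have h4 : ‖mk g • ha.toLp - hb.toLp‖ ≤
      ‖mk g • φ - mk g • ha.toLp‖ + ‖mk g • φ - ψ‖ + ‖ψ - hb.toLp‖ := by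
    have : mk g • ha.toLp - hb.toLp =
        -(mk g • φ - mk g • ha.toLp) + (mk g • φ - ψ) + (ψ - hb.toLp) := by abel
    rw [this]
    refine (norm_add_le _ _).trans (add_le_add_left ?_ _)
    refine (norm_add_le _ _).trans (add_le_add_left ?_ _)
    rw [norm_neg]
  linarith

variable {ι : Type*}

/-- The orbits of the diagonal translation action are closed away from zero. -/
lemma mem_orbit_of_mem_closure {w w' : ι → Lp ℝ 2 (Measure.haar : Measure G)} {n : ι}
    (hn : w' n ≠ 0) (hw : w' ∈ closure (MulAction.orbit Gᵈᵐᵃ w)) :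
    w' ∈ MulAction.orbit Gᵈᵐᵃ w := by
  obtain ⟨C, hC, hCn⟩ := exists_isCompact_le_norm_smul_sub (w n) (w' n) hn
  have hN : {z : ι → Lp ℝ 2 (Measure.haar : Measure G) | ‖z n - w' n‖ < ‖w' n‖ / 2} ∈ 𝓝 w' := by
    refine IsOpen.mem_nhds (isOpen_lt (by fun_prop) continuous_const) ?_
    simpa using hn
  have hcomp : IsCompact ((fun g : G => mk g • w) '' C) :=
    hC.image (continuous_mk.smul continuous_const)
  have h1 : w' ∈ closure ((fun g : G => mk g • w) '' C) := by
    rw [mem_closure_iff_nhds] at hw ⊢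
    intro t ht
    obtain ⟨z, ⟨hz1, hz2⟩, ⟨g, rfl⟩⟩ := hw _ (inter_mem ht hN)
    refine ⟨_, hz1, mk.symm g, ?_, rfl⟩
    by_contra hg
    exact absurd hz2 (not_lt.2 (hCn _ hg))
  rw [hcomp.isClosed.closure_eq] at h1
  obtain ⟨g, -, hg⟩ := h1
  exact ⟨mk g, hg⟩

/-- The stabilizer of a family of square integrable functions under translations. -/
def translationStabilizer (w : ι → Lp ℝ 2 (Measure.haar : Measure G)) : Subgroup G where
  carrier := {k | mk k • w = w}
  mul_mem' {a b} ha hb := by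
    change mk (a * b) • w = w
    rw [mk_mul, mul_smul, ha, hb]
  one_mem' := by
    change mk 1 • w = w
    rw [mk_one, one_smul]
  inv_mem' {a} ha := by
    change mk a⁻¹ • w = w
    rw [mk_inv, inv_smul_eq_iff]
    exact ha.symm

lemma mem_translationStabilizer {w : ι → Lp ℝ 2 (Measure.haar : Measure G)} {k : G} :
    k ∈ translationStabilizer w ↔ mk k • w = w := Iff.rfl

lemma isCompact_translationStabilizer {w : ι → Lp ℝ 2 (Measure.haar : Measure G)} {n : ι}
    (hn : w n ≠ 0) : IsCompact (translationStabilizer w : Set G) := by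
  obtain ⟨C, hC, hCn⟩ := exists_isCompact_le_norm_smul_sub (w n) (w n) hn
  refine hC.of_isClosed_subset ?_ fun k hk => ?_
  · exact isClosed_eq (f := fun k : G => mk k • w) (continuous_mk.smul continuous_const)
      continuous_const
  · by_contra hg
    have h1 := hCn _ hg
    have h2 : mk k • w n = w n := congrFun hk n
    rw [h2, sub_self, norm_zero] at h1
    have := norm_pos_iff.2 hn
    linarith

end Translations

/-! ### Measurable right inverses of continuous maps -/

section MeasurableSection

/-- A continuous map on a compact metrizable space has a measurable right inverse: after
parametrizing the space by the Cantor set, take the least parameter in each fibre. -/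
lemma exists_measurable_section_of_compactSpace {K W : Type*} [TopologicalSpace K] [CompactSpace K]
    [TopologicalSpace.MetrizableSpace K] [MeasurableSpace K] [BorelSpace K] [Nonempty K]
    [TopologicalSpace W] [T2Space W] [MeasurableSpace W] [BorelSpace W] {o : K → W}
    (ho : Continuous o) :
    ∃ s : W → K, Measurable s ∧ ∀ y ∈ Set.range o, o (s y) = y := by
  classical
  let := TopologicalSpace.metrizableSpaceMetric K
  obtain ⟨r0, hr0, hr0s⟩ := exists_nat_bool_continuous_surjective_of_compact K
  let r : cantorSet → K := r0 ∘ cantorSetHomeomorphNatToBool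
  have hr : Continuous r := hr0.comp cantorSetHomeomorphNatToBool.continuous
  have hrs : Function.Surjective r := hr0s.comp cantorSetHomeomorphNatToBool.surjective
  have hor : Continuous (o ∘ r) := ho.comp hr
  have hcs : CompactSpace cantorSet := isCompact_iff_compactSpace.1 isCompact_cantorSet
  let t : W → ℝ := fun y => sInf (Subtype.val '' ((o ∘ r) ⁻¹' {y}))
  have hcomp : ∀ y, IsCompact (Subtype.val '' ((o ∘ r) ⁻¹' {y})) := fun y =>
    ((isClosed_singleton.preimage hor).isCompact).image continuous_subtype_val
  have hmem : ∀ y ∈ Set.range o, t y ∈ Subtype.val '' ((o ∘ r) ⁻¹' {y}) := by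
    rintro y ⟨k, rfl⟩
    obtain ⟨c, hc⟩ := hrs k
    exact (hcomp _).sInf_mem ⟨c, c, by simp [hc], rfl⟩
  have hrange : IsCompact (Set.range o) := isCompact_range ho
  obtain ⟨c0⟩ : Nonempty cantorSet := ⟨(hrs (Classical.arbitrary K)).choose⟩
  have htm : ∀ a : ℝ, MeasurableSet {y | y ∈ Set.range o ∧ t y ≤ a} := by
    intro a
    have : {y | y ∈ Set.range o ∧ t y ≤ a} = (o ∘ r) '' {c | (c : ℝ) ≤ a} := by
      ext y
      constructor
      · rintro ⟨hy, hya⟩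
        obtain ⟨c, hc, hct⟩ := hmem y hy
        exact ⟨c, by simpa [hct] using hya, hc⟩
      · rintro ⟨c, hc, rfl⟩
        exact ⟨⟨r c, rfl⟩, (csInf_le (hcomp _).bddBelow ⟨c, rfl, rfl⟩).trans hc⟩
    rw [this]
    exact (((isClosed_le continuous_subtype_val continuous_const).isCompact).image
      hor).measurableSet
  let t' : W → ℝ := fun y => if y ∈ Set.range o then t y else c0
  have ht'm : Measurable t' := by
    refine measurable_of_Iic fun a => ?_
    have : t' ⁻¹' Set.Iic a = {y | y ∈ Set.range o ∧ t y ≤ a} ∪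
        ((Set.range o)ᶜ ∩ {_y | (c0 : ℝ) ≤ a}) := by
      ext y
      by_cases hy : y ∈ Set.range o
      · simp only [Set.mem_preimage, t', Set.mem_union, Set.mem_inter_iff,
          Set.mem_compl_iff, hy, Set.mem_ofPred_eq, Set.mem_Iic]
        tauto
      · simp only [Set.mem_preimage, t', Set.mem_union, Set.mem_inter_iff,
          Set.mem_compl_iff, hy, Set.mem_ofPred_eq, Set.mem_Iic]
        tauto
    rw [this]
    exact (htm a).union (hrange.measurableSet.compl.inter (.const _))
  have ht'mem : ∀ y, t' y ∈ cantorSet := by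
    intro y
    by_cases hy : y ∈ Set.range o
    · obtain ⟨c, -, hct⟩ := hmem y hy
      simp only [t', if_pos hy, ← hct]
      exact c.2
    · simp only [t', if_neg hy]
      exact c0.2
  refine ⟨fun y => r ⟨t' y, ht'mem y⟩, hr.measurable.comp (ht'm.subtype_mk), fun y hy => ?_⟩
  obtain ⟨c, hc, hct⟩ := hmem y hy
  have : (⟨t' y, ht'mem y⟩ : cantorSet) = c := Subtype.ext (by simp only [t', if_pos hy, hct])
  change o (r ⟨t' y, ht'mem y⟩) = y
  rw [this]
  exact hc

/-- A continuous map on a `σ`-compact metrizable space has a measurable right inverse. -/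
lemma exists_measurable_section {K W : Type*} [TopologicalSpace K] [SigmaCompactSpace K]
    [TopologicalSpace.MetrizableSpace K] [MeasurableSpace K] [BorelSpace K] [Nonempty K]
    [TopologicalSpace W] [T2Space W] [MeasurableSpace W] [BorelSpace W] {o : K → W}
    (ho : Continuous o) :
    ∃ s : W → K, Measurable s ∧ ∀ y ∈ Set.range o, o (s y) = y := by
  classical
  let C : ℕ → Set K := compactCovering K
  have hC : ∀ n, IsCompact (C n) := isCompact_compactCovering K
  have hs : ∀ n, ∃ s : W → K, Measurable s ∧ ∀ y ∈ o '' C n, o (s y) = y := by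
    intro n
    rcases (C n).eq_empty_or_nonempty with h | h
    · exact ⟨fun _ => Classical.arbitrary K, measurable_const, by simp [h]⟩
    · have := h.to_subtype
      have := isCompact_iff_compactSpace.1 (hC n)
      obtain ⟨s, hs, hs'⟩ := exists_measurable_section_of_compactSpace (K := C n)
        (o := fun k => o k) (ho.comp continuous_subtype_val)
      refine ⟨fun y => s y, measurable_subtype_coe.comp hs, ?_⟩
      rintro y ⟨k, hk, rfl⟩
      exact hs' _ ⟨⟨k, hk⟩, rfl⟩
  choose s hsm hso using hs
  -- glue the sections `s n` along the sets of points first reached from `C n`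
  have hmeas : ∀ n, MeasurableSet (disjointed (fun n => o '' C n) n) := fun n =>
    MeasurableSet.disjointed (fun n => ((hC n).image ho).measurableSet) n
  obtain ⟨S, hS, hSe⟩ := exists_measurable_piecewise _ hmeas s hsm (fun i j hij => by
    change Set.EqOn (s i) (s j) _
    rw [Set.disjoint_iff_inter_eq_empty.1 (disjoint_disjointed _ hij)]
    exact Set.eqOn_empty _ _)
  refine ⟨S, hS, ?_⟩
  rintro y ⟨k, rfl⟩
  have h1 : o k ∈ ⋃ n, o '' C n := by
    obtain ⟨n, hn⟩ := Set.mem_iUnion.1 ((iUnion_compactCovering K).ge (Set.mem_univ k))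
    exact Set.mem_iUnion.2 ⟨n, k, hn, rfl⟩
  rw [← iUnion_disjointed] at h1
  obtain ⟨n, hn⟩ := Set.mem_iUnion.1 h1
  rw [hSe n hn]
  exact hso n _ (disjointed_subset (fun n => o '' C n) n hn)

end MeasurableSection

/-! ### Sections of invariant functions -/

section Slices

open scoped ENNReal

variable {X G : Type*} [MeasurableSpace X] [MeasurableSpace G] {μ : Measure X} [SFinite μ]
  {m : Measure G} [SFinite m]

open Classical in
/-- The section `h(x, ·)` of a square integrable function on `X × G`, as an element of `L²`
(and `0` for the negligible set of `x` where the section is not square integrable). -/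
def slice (h : Lp ℝ 2 (μ.prod m)) (x : X) : Lp ℝ 2 m :=
  if hx : MemLp (fun g => h (x, g)) 2 m then hx.toLp else 0

lemma memLp_section_iff (h : Lp ℝ 2 (μ.prod m)) (x : X) :
    MemLp (fun g => h (x, g)) 2 m ↔ eLpNorm (fun g => h (x, g)) 2 m < ∞ :=
  ⟨fun hx => hx.2, fun hx => ⟨((Lp.stronglyMeasurable h).measurable.comp
    measurable_prodMk_left).aestronglyMeasurable, hx⟩⟩

lemma ae_memLp_section (h : Lp ℝ 2 (μ.prod m)) :
    ∀ᵐ x ∂μ, MemLp (fun g => h (x, g)) 2 m := by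
  have h1 : Integrable (fun q => h q ^ 2) (μ.prod m) := (Lp.memLp h).integrable_sq
  filter_upwards [h1.prod_right_ae] with x hx
  exact (memLp_two_iff_integrable_sq ((Lp.stronglyMeasurable h).measurable.comp
    measurable_prodMk_left).aestronglyMeasurable).2 hx

lemma slice_ae_eq (h : Lp ℝ 2 (μ.prod m)) {x : X} (hx : MemLp (fun g => h (x, g)) 2 m) :
    slice h x =ᵐ[m] fun g => h (x, g) := by
  rw [slice, dif_pos hx]
  exact hx.coeFn_toLp

lemma measurable_eLpNorm_section {u : X × G → ℝ} (hu : Measurable u) :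
    Measurable fun x => eLpNorm (fun g => u (x, g)) 2 m := by
  simp only [eLpNorm_eq_lintegral_rpow_enorm_toReal (two_ne_zero) (ENNReal.ofNat_ne_top)]
  refine Measurable.pow_const ?_ _
  exact Measurable.lintegral_prod_right' (f := fun q : X × G => ‖u q‖ₑ ^ (2 : ℝ≥0∞).toReal)
    (hu.enorm.pow_const _)

/-- The balls of a second countable space generate its topology, so it is enough to know that the
distance of `slice h x` to any vector is measurable in `x`. -/
lemma measurableSet_preimage_slice [SecondCountableTopology (Lp ℝ 2 m)] (h : Lp ℝ 2 (μ.prod m))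
    {U : Set (Lp ℝ 2 m)} (hU : IsOpen U) : MeasurableSet (slice h ⁻¹' U) := by
  have hh : Measurable h := (Lp.stronglyMeasurable h).measurable
  have hM : MeasurableSet {x | MemLp (fun g => h (x, g)) 2 m} := by
    simp only [memLp_section_iff]
    exact measurableSet_lt (measurable_eLpNorm_section hh) measurable_const
  have hdist : ∀ a : Lp ℝ 2 m, Measurable fun x => edist (slice h x) a := by
    intro a
    have ha : Measurable a := (Lp.stronglyMeasurable a).measurable
    classical
    have : (fun x => edist (slice h x) a) = fun x =>
        if MemLp (fun g => h (x, g)) 2 m then eLpNorm (fun g => h (x, g) - a g) 2 m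
          else edist 0 a := by
      funext x
      split_ifs with hx
      · rw [slice, dif_pos hx, Lp.edist_def]
        exact eLpNorm_congr_ae (hx.coeFn_toLp.sub (ae_eq_refl _))
      · rw [slice, dif_neg hx]
    rw [this]
    exact Measurable.ite hM (measurable_eLpNorm_section (u := fun q => h q - a q.2)
      (hh.sub (ha.comp measurable_snd))) measurable_const
  obtain ⟨T, hTI, hTc, hTU⟩ := TopologicalSpace.isOpen_biUnion_countable
    {q : Lp ℝ 2 m × ℝ≥0∞ | Metric.eball q.1 q.2 ⊆ U} (fun q => Metric.eball q.1 q.2)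
    fun _ _ => Metric.isOpen_eball
  have hUe : U = ⋃ q ∈ T, Metric.eball q.1 q.2 := by
    rw [hTU]
    ext a
    constructor
    · intro ha
      obtain ⟨r, hr, hrU⟩ := EMetric.isOpen_iff.1 hU a ha
      exact Set.mem_biUnion (x := (a, r)) hrU (Metric.mem_eball_self hr)
    · intro ha
      obtain ⟨q, hq, haq⟩ := Set.mem_iUnion₂.1 ha
      exact hq haq
  rw [hUe, Set.preimage_iUnion₂]
  exact .biUnion hTc fun q _ => measurableSet_lt (hdist q.1) measurable_const

lemma eq_zero_of_ae_slice_eq_zero {h : Lp ℝ 2 (μ.prod m)} (h0 : ∀ᵐ x ∂μ, slice h x = 0) :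
    h = 0 := by
  rw [Lp.eq_zero_iff_ae_eq_zero]
  have hm : MeasurableSet {q : X × G | h q = 0} :=
    (Lp.stronglyMeasurable h).measurable (measurableSet_singleton 0)
  refine (Measure.ae_prod_iff_ae_ae hm).2 ?_
  filter_upwards [h0, ae_memLp_section h] with x h1 h2
  have h3 := slice_ae_eq h h2
  rw [h1] at h3
  filter_upwards [h3, Lp.coeFn_zero ℝ 2 m] with g h4 h5
  rw [← h4, h5]
  rfl

end Slices

namespace RandomTransformation

open scoped Pointwise

variable {Y X : Type*} [MeasurableSpace Y] [MeasurableSpace X] {p : Measure Y}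
  [IsProbabilityMeasure p] {μ : Measure X} [IsProbabilityMeasure μ]

/-- Ergodicity for maps that are equivariant up to a group acting by homeomorphisms: almost all
values lie in the closure of a single orbit. -/
lemma exists_ae_mem_closure_orbit (f : RandomTransformation p μ) {M W : Type*} [Group M]
    [TopologicalSpace W] [SecondCountableTopology W] [MulAction M W] [ContinuousConstSMul M W]
    {F : X → W} (hF : ∀ U, IsOpen U → MeasurableSet (F ⁻¹' U))
    (hinv : ∀ᵐ q ∂(p.prod μ), F q.2 ∈ MulAction.orbit M (F (f.map q.1 q.2)))
    {Q : X → Prop} (hQ : ∀ᵐ x ∂μ, Q x) :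
    ∃ x₀, Q x₀ ∧ ∀ᵐ x ∂μ, F x ∈ closure (MulAction.orbit M (F x₀)) := by
  -- the saturation `s U` is invariant, so `F x ∈ s U` holds almost everywhere or almost nowhere;
  -- any `x₀` for which the alternative is the generic one for each basic open set will do
  let s : Set W → Set W := fun U => ⋃ m : M, m • U
  have hso : ∀ U, IsOpen U → IsOpen (s U) := fun U hU => isOpen_iUnion fun m => hU.smul m
  have hsat : ∀ U (m : M) (w : W), m • w ∈ s U ↔ w ∈ s U := by
    intro U m w
    simp only [s, Set.mem_iUnion, Set.mem_smul_set_iff_inv_smul_mem]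
    constructor
    · rintro ⟨k, hk⟩
      exact ⟨m⁻¹ * k, by simpa [mul_smul] using hk⟩
    · rintro ⟨k, hk⟩
      exact ⟨m * k, by simpa [mul_smul] using hk⟩
  have hdich : ∀ U, IsOpen U → (∀ᵐ x ∂μ, F x ∈ s U) ∨ ∀ᵐ x ∂μ, F x ∉ s U := by
    intro U hU
    refine f.ae_mem_or_ae_notMem (hF _ (hso U hU)) ?_
    filter_upwards [hinv] with q hq
    obtain ⟨m, hm⟩ := hq
    change F _ ∈ s U ↔ F _ ∈ s U
    rw [← hm]
    exact (hsat U m _).symm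
  have hgen : ∀ᵐ x ∂μ, ∀ U ∈ TopologicalSpace.countableBasis W,
      ((∀ᵐ x ∂μ, F x ∈ s U) → F x ∈ s U) ∧ ((∀ᵐ x ∂μ, F x ∉ s U) → F x ∉ s U) := by
    refine (ae_ball_iff (TopologicalSpace.countable_countableBasis W)).2 fun U hU => ?_
    by_cases h1 : ∀ᵐ x ∂μ, F x ∈ s U
    · have h2 : ¬ ∀ᵐ x ∂μ, F x ∉ s U := fun h2 => by
        obtain ⟨x, hx1, hx2⟩ := (h1.and h2).exists
        exact hx2 hx1
      filter_upwards [h1] with x hx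
      exact ⟨fun _ => hx, fun h => absurd h h2⟩
    · have h2 := (hdich U (TopologicalSpace.isOpen_of_mem_countableBasis hU)).resolve_left h1
      filter_upwards [h2] with x hx
      exact ⟨fun h => absurd h h1, fun _ => hx⟩
  obtain ⟨x₀, hx₀, hQx⟩ := (hgen.and hQ).exists
  refine ⟨x₀, hQx, ?_⟩
  filter_upwards [hgen] with x hx
  rw [(TopologicalSpace.isBasis_countableBasis W).mem_closure_iff]
  intro U hU hxU
  have hxs : F x ∈ s U := Set.mem_iUnion.2 ⟨1, by simpa using hxU⟩
  have h1 : ∀ᵐ x ∂μ, F x ∈ s U :=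
    (hdich U (TopologicalSpace.isOpen_of_mem_countableBasis hU)).resolve_right
      fun h => (hx U hU).2 h hxs
  obtain ⟨m, hm⟩ := Set.mem_iUnion.1 ((hx₀ U hU).1 h1)
  exact ⟨m⁻¹ • F x₀, Set.mem_smul_set_iff_inv_smul_mem.1 hm, m⁻¹, rfl⟩

end RandomTransformation

namespace RandomCocycle

open DomMulAct hiding mk

variable {Y X : Type*} [MeasurableSpace Y] [MeasurableSpace X] {p : Measure Y}
  [IsProbabilityMeasure p] {μ : Measure X} [IsProbabilityMeasure μ] {f : RandomTransformation p μ}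
  {G : Type*} [Group G] [TopologicalSpace G] [IsTopologicalGroup G] [LocallyCompactSpace G]
  [SecondCountableTopology G] [T2Space G] [MeasurableSpace G] [BorelSpace G]

/-- The sections of an invariant function on `X × G` are translated by the cocycle. -/
lemma ae_mk_smul_slice_eq (A : RandomCocycle f G) {h : Lp ℝ 2 (μ.prod (Measure.haar : Measure G))}
    (hh : transferOp A.measurePreserving_groupStep h = h) :
    ∀ᵐ q ∂(p.prod μ), DomMulAct.mk (A.map q.1 q.2) • slice h (f.map q.1 q.2) = slice h q.2 := by
  rw [transferOp_eq_self_iff] at hh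
  have h1 : ∀ᵐ r ∂((p.prod μ).prod (Measure.haar : Measure G)),
      h (f.map r.1.1 r.1.2, A.map r.1.1 r.1.2 * r.2) = h (r.1.2, r.2) :=
    (measurePreserving_prodAssoc p μ Measure.haar).quasiMeasurePreserving.ae hh
  have hmem := ae_memLp_section h
  filter_upwards [Measure.ae_ae_of_ae_prod h1,
    (measurePreserving_snd (μ := p) (ν := μ)).quasiMeasurePreserving.ae hmem,
    f.measurePreserving_map.quasiMeasurePreserving.ae hmem] with q hq1 hq2 hq3
  apply Lp.ext
  have h4 := (measurePreserving_smul (A.map q.1 q.2)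
    (Measure.haar : Measure G)).quasiMeasurePreserving.ae (slice_ae_eq h hq3)
  filter_upwards [smul_Lp_ae_eq (DomMulAct.mk (A.map q.1 q.2)) (slice h (f.map q.1 q.2)), h4,
    slice_ae_eq h hq2, hq1] with g h5 h6 h7 h8
  rw [h5, h7, Equiv.symm_apply_apply, h6]
  exact h8

/-- The sections of a sequence of invariant functions, not all zero, all lie in a single orbit of
translations, and they are moved to a fixed family by translations that depend measurably on the
point of `X`. -/
theorem exists_measurable_mk_smul_slice_eq (A : RandomCocycle f G)
    {h : ℕ → Lp ℝ 2 (μ.prod (Measure.haar : Measure G))}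
    (hh : ∀ n, transferOp A.measurePreserving_groupStep (h n) = h n) {n : ℕ} (hn : h n ≠ 0) :
    ∃ (w : ℕ → Lp ℝ 2 (Measure.haar : Measure G)) (P : X → G), w n ≠ 0 ∧ Measurable P ∧
      ∀ᵐ x ∂μ, ∀ k, DomMulAct.mk (P x) • slice (h k) x = w k := by
  let F : X → ℕ → Lp ℝ 2 (Measure.haar : Measure G) := fun x k => slice (h k) x
  have hinv : ∀ᵐ q ∂(p.prod μ), DomMulAct.mk (A.map q.1 q.2) • F (f.map q.1 q.2) = F q.2 := by
    filter_upwards [ae_all_iff.2 fun k => A.ae_mk_smul_slice_eq (hh k)] with q hq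
    exact funext hq
  let : MeasurableSpace (Lp ℝ 2 (Measure.haar : Measure G)) := borel _
  have : BorelSpace (Lp ℝ 2 (Measure.haar : Measure G)) := ⟨rfl⟩
  have hFm : Measurable F := measurable_pi_lambda _ fun k =>
    measurable_of_isOpen fun U hU => measurableSet_preimage_slice (h k) hU
  -- translations preserve norms, so by ergodicity the section of `h n` vanishes for almost every
  -- `x` or for almost none
  have hne : ∀ᵐ x ∂μ, F x n ≠ 0 := by
    have hm : MeasurableSet {x | F x n ≠ 0} :=
      ((measurable_pi_apply n).comp hFm) (measurableSet_singleton 0).compl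
    refine (f.ae_mem_or_ae_notMem hm ?_).resolve_right fun h0 => hn ?_
    · filter_upwards [hinv] with q hq
      have h1 : ‖F q.2 n‖ = ‖F (f.map q.1 q.2) n‖ := by
        rw [← hq]
        exact norm_smul_Lp _ _
      change F _ n ≠ 0 ↔ F _ n ≠ 0
      rw [← norm_ne_zero_iff, ← norm_ne_zero_iff (a := F q.2 n), h1]
    · refine eq_zero_of_ae_slice_eq_zero ?_
      filter_upwards [h0] with x hx
      simpa using hx
  obtain ⟨x₀, hx₀, hcl⟩ := f.exists_ae_mem_closure_orbit (M := Gᵈᵐᵃ) (F := F)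
    (fun U hU => hFm hU.measurableSet) (hinv.mono fun q hq => ⟨_, hq⟩) hne
  let o : G → ℕ → Lp ℝ 2 (Measure.haar : Measure G) := fun g => DomMulAct.mk g⁻¹ • F x₀
  have ho : Continuous o := (continuous_mk.comp continuous_inv).smul continuous_const
  obtain ⟨s, hs, hso⟩ := exists_measurable_section ho
  refine ⟨F x₀, fun x => s (F x), hx₀, hs.comp hFm, ?_⟩
  filter_upwards [hcl, hne] with x hx hxn
  obtain ⟨c, hc⟩ := mem_orbit_of_mem_closure hxn hx
  have h1 : o (s (F x)) = F x := hso _ ⟨(DomMulAct.mk.symm c)⁻¹, by simpa [o] using hc⟩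
  have h2 : DomMulAct.mk (s (F x)) • F x = F x₀ := by
    change DomMulAct.mk (s (F x))⁻¹ • F x₀ = F x at h1
    rw [mk_inv, inv_smul_eq_iff] at h1
    exact h1.symm
  exact fun k => congrFun h2 k

end RandomCocycle

/-! ### The conjugate cocycle and its invariant functions -/

namespace RandomCocycle

open DomMulAct hiding mk

variable {Y X : Type*} [MeasurableSpace Y] [MeasurableSpace X] {p : Measure Y}
  [IsProbabilityMeasure p] {μ : Measure X} [IsProbabilityMeasure μ] {f : RandomTransformation p μ}
  {G : Type*} [Group G] [TopologicalSpace G] [IsTopologicalGroup G] [LocallyCompactSpace G]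
  [SecondCountableTopology G] [T2Space G] [MeasurableSpace G] [BorelSpace G]

open Classical in
/-- The cocycle `P(f_i(x))⁻¹ A_i(x) P(x)`, replaced by the identity where it is not in `H`. -/
def conjugate (A : RandomCocycle f G) {P : X → G} (hP : Measurable P) {H : Subgroup G}
    (hH : MeasurableSet (H : Set G)) : RandomCocycle f G where
  map i x := if (P (f.map i x))⁻¹ * A.map i x * P x ∈ H then (P (f.map i x))⁻¹ * A.map i x * P x
    else 1
  measurable := by
    have h : Measurable fun q : Y × X => (P (f.map q.1 q.2))⁻¹ * A.map q.1 q.2 * P q.2 :=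
      ((hP.comp f.measurable_map).inv.mul A.measurable).mul (hP.comp measurable_snd)
    exact Measurable.ite (h hH) h measurable_const

lemma conjugate_mem (A : RandomCocycle f G) {P : X → G} (hP : Measurable P) {H : Subgroup G}
    (hH : MeasurableSet (H : Set G)) (i : Y) (x : X) : (A.conjugate hP hH).map i x ∈ H := by
  unfold conjugate
  dsimp only
  split_ifs with h
  · exact h
  · exact H.one_mem

lemma cohomologous_of_ae_map_eq {A B : RandomCocycle f G} {P : X → G} (hP : Measurable P)
    (h : ∀ᵐ q ∂(p.prod μ), B.map q.1 q.2 = (P (f.map q.1 q.2))⁻¹ * A.map q.1 q.2 * P q.2) :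
    A.Cohomologous B :=
  ⟨P, hP, (RandomTransformation.measurePreserving_coord p μ 0).quasiMeasurePreserving.ae h⟩

/-- If `P` moves the sections of invariant functions to a fixed family `w`, then it conjugates the
cocycle into the stabilizer of `w`. -/
lemma ae_conj_mem_translationStabilizer (A : RandomCocycle f G)
    {h : ℕ → Lp ℝ 2 (μ.prod (Measure.haar : Measure G))}
    (hh : ∀ n, transferOp A.measurePreserving_groupStep (h n) = h n)
    {w : ℕ → Lp ℝ 2 (Measure.haar : Measure G)} {P : X → G}
    (hw : ∀ᵐ x ∂μ, ∀ k, DomMulAct.mk (P x) • slice (h k) x = w k) :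
    ∀ᵐ q ∂(p.prod μ),
      (P (f.map q.1 q.2))⁻¹ * A.map q.1 q.2 * P q.2 ∈ translationStabilizer w := by
  filter_upwards [ae_all_iff.2 fun k => A.ae_mk_smul_slice_eq (hh k),
    (measurePreserving_snd (μ := p) (ν := μ)).quasiMeasurePreserving.ae hw,
    f.measurePreserving_map.quasiMeasurePreserving.ae hw] with q h1 h2 h3
  rw [mem_translationStabilizer]
  funext k
  rw [Pi.smul_apply, mk_mul, mk_mul, mul_smul, mul_smul, mk_inv]
  nth_rewrite 1 [← h3 k]
  rw [inv_smul_smul, h1, h2]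

lemma measurePreserving_fiber_mul_left {Q : X → G} (hQ : Measurable Q) :
    MeasurePreserving (fun r : X × G => (r.1, Q r.1 * r.2)) (μ.prod Measure.haar)
      (μ.prod (Measure.haar : Measure G)) :=
  (MeasurePreserving.id μ).skew_product
    ((hQ.comp measurable_fst).mul measurable_snd)
    (ae_of_all _ fun x => map_mul_left_eq_self Measure.haar (Q x))

/-- If `P` makes constant the sections of a dense sequence of `A`-invariant functions, then every
invariant function of the conjugate cocycle depends on `G` only, and is invariant under the
stabilizer of these sections. -/
theorem exists_ae_eq_snd_of_transferOp_eq {A B : RandomCocycle f G}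
    {h : ℕ → Lp ℝ 2 (μ.prod (Measure.haar : Measure G))}
    (hdense : ∀ u, transferOp A.measurePreserving_groupStep u = u → u ∈ closure (Set.range h))
    {w : ℕ → Lp ℝ 2 (Measure.haar : Measure G)} {P : X → G} (hP : Measurable P)
    (hw : ∀ᵐ x ∂μ, ∀ k, DomMulAct.mk (P x) • slice (h k) x = w k)
    (hB : ∀ᵐ q ∂(p.prod μ), B.map q.1 q.2 = (P (f.map q.1 q.2))⁻¹ * A.map q.1 q.2 * P q.2)
    {v : Lp ℝ 2 (μ.prod (Measure.haar : Measure G))}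
    (hv : transferOp B.measurePreserving_groupStep v = v) :
    ∃ φ : Lp ℝ 2 (Measure.haar : Measure G),
      (∀ k ∈ translationStabilizer w, DomMulAct.mk k • φ = φ) ∧
        v =ᵐ[μ.prod Measure.haar] fun r => φ r.2 := by
  have hΨ := measurePreserving_fiber_mul_left (μ := μ) hP
  have hΨ' := measurePreserving_fiber_mul_left (μ := μ) hP.inv
  have hsnd := measurePreserving_snd (μ := μ) (ν := (Measure.haar : Measure G))
  have hsnd' := measurePreserving_snd (μ := p) (ν := μ.prod (Measure.haar : Measure G))
  -- the function `u(x, g) = v(x, P(x)⁻¹ g)` is `A`-invariant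
  have hfix : transferOp A.measurePreserving_groupStep (koopman hΨ' v) = koopman hΨ' v := by
    rw [transferOp_eq_self_iff] at hv ⊢
    have e1 := coeFn_koopman hΨ' v
    have hpq := ((MeasurePreserving.id p).prod hΨ').quasiMeasurePreserving.ae hv
    have hB' : ∀ᵐ r ∂(p.prod (μ.prod (Measure.haar : Measure G))), B.map r.1 r.2.1 =
        (P (f.map r.1 r.2.1))⁻¹ * A.map r.1 r.2.1 * P r.2.1 :=
      (Measure.quasiMeasurePreserving_fst.comp (measurePreserving_prodAssoc p μ
        (Measure.haar : Measure G)).symm.quasiMeasurePreserving).ae hB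
    filter_upwards [A.measurePreserving_groupStep.quasiMeasurePreserving.ae e1,
      hsnd'.quasiMeasurePreserving.ae e1, hpq, hB'] with r h1 h2 h3 h4
    rw [h1, h2]
    refine Eq.trans ?_ h3
    congr 1
    simp [groupStep, h4, mul_assoc]
  have hinvol : koopman hΨ (koopman hΨ' v) = v := by
    apply Lp.ext
    filter_upwards [coeFn_koopman hΨ (koopman hΨ' v),
      hΨ.quasiMeasurePreserving.ae (coeFn_koopman hΨ' v)] with r h1 h2
    rw [h1, h2]
    simp
  have hconst : ∀ k, koopman hΨ (h k) = koopman hsnd (w k) := by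
    intro k
    apply Lp.ext
    have hm : MeasurableSet {r : X × G | h k (r.1, P r.1 * r.2) = w k r.2} :=
      measurableSet_eq_fun ((Lp.stronglyMeasurable (h k)).measurable.comp hΨ.measurable)
        ((Lp.stronglyMeasurable (w k)).measurable.comp measurable_snd)
    have h1 : ∀ᵐ r ∂(μ.prod (Measure.haar : Measure G)),
        h k (r.1, P r.1 * r.2) = w k r.2 := by
      refine (Measure.ae_prod_iff_ae_ae hm).2 ?_
      filter_upwards [hw, ae_memLp_section (h k)] with x h1 h2
      have h3 := (measurePreserving_smul (P x) (Measure.haar : Measure G)).quasiMeasurePreserving.ae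
        (slice_ae_eq (h k) h2)
      filter_upwards [smul_Lp_ae_eq (DomMulAct.mk (P x)) (slice (h k) x), h3] with g h4 h5
      rw [h1 k, Equiv.symm_apply_apply, h5] at h4
      exact h4.symm
    filter_upwards [coeFn_koopman hΨ (h k), coeFn_koopman hsnd (w k), h1] with r h2 h3 h4
    rw [h2, h3, h4]
  let V : Set (Lp ℝ 2 (Measure.haar : Measure G)) :=
    {φ | ∀ k ∈ translationStabilizer w, DomMulAct.mk k • φ = φ}
  have hV : IsClosed V := by
    have : V = ⋂ k ∈ translationStabilizer w, {φ | DomMulAct.mk k • φ = φ} := by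
      ext φ; simp [V]
    rw [this]
    exact isClosed_biInter fun k _ => isClosed_eq (continuous_const_smul _) continuous_id
  have hVc : IsClosed (koopman hsnd '' V) :=
    (koopman hsnd).isometry.isClosedEmbedding.isClosedMap _ hV
  have hmem : v ∈ koopman hsnd '' V := by
    rw [← hinvol, ← hVc.closure_eq]
    refine closure_mono ?_ (image_closure_subset_closure_image (koopman hΨ).continuous
      ⟨_, hdense _ hfix, rfl⟩)
    rintro _ ⟨_, ⟨k, rfl⟩, rfl⟩
    exact ⟨w k, fun c hc => congrFun hc k, (hconst k).symm⟩
  obtain ⟨φ, hφ, rfl⟩ := hmem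
  exact ⟨φ, hφ, coeFn_koopman hsnd φ⟩

end RandomCocycle

/-! ### Transport measures of stationary measures -/

namespace RandomCocycle

open scoped Pointwise ENNReal
open DomMulAct hiding mk

variable {Y X : Type*} [MeasurableSpace Y] [MeasurableSpace X] {p : Measure Y}
  [IsProbabilityMeasure p] {μ : Measure X} [IsProbabilityMeasure μ] {f : RandomTransformation p μ}
  {G : Type*} [Group G] [TopologicalSpace G] [IsTopologicalGroup G] [LocallyCompactSpace G]
  [SecondCountableTopology G] [T2Space G] [MeasurableSpace G] [BorelSpace G]
  {Z : Type*} [MeasurableSpace Z] [MulAction G Z] [MeasurableSMul₂ G Z]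

lemma IsStationary.measurePreserving {B : RandomCocycle f G} {π : Measure (X × Z)}
    [IsProbabilityMeasure π] (h : B.IsStationary π) :
    MeasurePreserving (fun q : Y × (X × Z) => B.fiberMap q.1 q.2) (p.prod π) π := by
  have hm : Measurable fun q : Y × (X × Z) => B.fiberMap q.1 q.2 := by
    have h1 : Measurable fun q : Y × (X × Z) => (q.1, q.2.1) := by fun_prop
    exact (f.measurable_map.comp h1).prodMk
      ((B.measurable.comp h1).smul (measurable_snd.comp measurable_snd))
  refine ⟨hm, Measure.ext fun S hS => ?_⟩
  rw [Measure.map_apply hm hS, Measure.prod_apply (hm hS), ← h.2 S hS]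
  refine lintegral_congr fun i => ?_
  have hi : Measurable (B.fiberMap (Z := Z) i) := hm.comp measurable_prodMk_left
  rw [Measure.map_apply hi hS]
  rfl

/-- The distribution of `(x, g)` in `X × G`, for `(x, z)` of law `π` and `g` uniform in `N`,
on the event `g⁻¹ z ∈ D`. -/
def transportMeasure (π : Measure (X × Z)) (N : Set G) (D : Set Z) : Measure (X × G) :=
  ((π.prod (Measure.haar.restrict N)).restrict {r | r.2⁻¹ • r.1.2 ∈ D}).map fun r => (r.1.1, r.2)

lemma measurable_inv_smul_snd : Measurable fun r : (X × Z) × G => r.2⁻¹ • r.1.2 :=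
  measurable_snd.inv.smul (measurable_snd.comp measurable_fst)

lemma transportMeasure_le {π : Measure (X × Z)} [IsProbabilityMeasure π]
    (hπ : π.map Prod.fst = μ) {N : Set G} {D : Set Z} :
    transportMeasure π N D ≤ μ.prod (Measure.haar : Measure G) := by
  have h1 : (π.prod (Measure.haar : Measure G)).map (fun r => (r.1.1, r.2)) =
      μ.prod Measure.haar := by
    have h2 := Measure.map_prod_map π (Measure.haar : Measure G) measurable_fst measurable_id
    rw [hπ, Measure.map_id] at h2
    exact h2.symm
  rw [← h1]
  refine Measure.map_mono ?_ (by fun_prop)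
  exact Measure.restrict_le_self.trans (Measure.prod_mono le_rfl Measure.restrict_le_self)

lemma transportMeasure_prod {π : Measure (X × Z)} [IsProbabilityMeasure π] {N : Set G}
    {D : Set Z} (hD : MeasurableSet D) {D' : Set X} (hD' : MeasurableSet D') {S : Set G}
    (hS : MeasurableSet S) :
    transportMeasure π N D (D' ×ˢ S) =
      ∫⁻ g in S, π {w | w.1 ∈ D' ∧ g⁻¹ • w.2 ∈ D} ∂(Measure.haar.restrict N) := by
  have hR : MeasurableSet {r : (X × Z) × G | r.2⁻¹ • r.1.2 ∈ D} := measurable_inv_smul_snd hD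
  have hm : Measurable fun r : (X × Z) × G => (r.1.1, r.2) := by fun_prop
  rw [transportMeasure, Measure.map_apply hm (hD'.prod hS),
    Measure.restrict_apply (hm (hD'.prod hS)),
    Measure.prod_apply_symm ((hm (hD'.prod hS)).inter hR), ← lintegral_indicator hS]
  refine lintegral_congr fun g => ?_
  by_cases hg : g ∈ S
  · rw [Set.indicator_of_mem hg]
    congr 1
    ext w
    simp [hg]
  · rw [Set.indicator_of_notMem hg]
    convert measure_empty (μ := π)
    ext w
    simp [hg]

/-- As `(hg)⁻¹ (hz) = g⁻¹ z`, the transport measures of a stationary measure are stationary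
for the action on `X × G`. -/
lemma averageImage_transportMeasure {B : RandomCocycle f G} {π : Measure (X × Z)}
    [IsProbabilityMeasure π] (h : B.IsStationary π) {N : Set G} (hN : MeasurableSet N)
    (hBN : ∀ i x, (fun g => B.map i x * g) ⁻¹' N = N) {D : Set Z} (hD : MeasurableSet D) :
    averageImage p B.groupStep (transportMeasure π N D) = transportMeasure π N D := by
  set m : Measure G := Measure.haar.restrict N with hm
  set R : Set ((X × Z) × G) := {r | r.2⁻¹ • r.1.2 ∈ D} with hR
  have hRm : MeasurableSet R := measurable_inv_smul_snd hD
  let q : (X × Z) × G → X × G := fun r => (r.1.1, r.2)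
  have hq : Measurable q := by fun_prop
  let θ : Y × ((X × Z) × G) → (X × Z) × G :=
    fun r => (B.fiberMap r.1 r.2.1, B.map r.1 r.2.1.1 * r.2.2)
  have hmp : ∀ c : G, (fun g => c * g) ⁻¹' N = N → m.map (fun g => c * g) = m := by
    intro c hc
    have := (measurePreserving_mul_left Measure.haar c).restrict_preimage hN
    rw [hc] at this
    exact this.map_eq
  have hθ : MeasurePreserving θ (p.prod (π.prod m)) (π.prod m) := by
    have h1 : Measurable (Function.uncurry fun (r : Y × (X × Z)) (g : G) =>
        B.map r.1 r.2.1 * g) := by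
      have h2 : Measurable fun r : (Y × (X × Z)) × G => (r.1.1, r.1.2.1) := by fun_prop
      exact (B.measurable.comp h2).mul measurable_snd
    exact (h.measurePreserving.skew_product h1
      (ae_of_all _ fun r => hmp _ (hBN r.1 r.2.1))).comp (measurePreserving_prodAssoc p π m).symm
  have hθR : θ ⁻¹' R = Set.univ ×ˢ R := by
    ext r
    simp [θ, R, fiberMap, mul_smul]
  have h1 : p.prod (transportMeasure π N D) =
      ((p.prod (π.prod m)).restrict (Set.univ ×ˢ R)).map (Prod.map id q) := by
    rw [← Measure.prod_restrict, Measure.restrict_univ, ← Measure.map_prod_map _ _ measurable_id hq,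
      Measure.map_id]
    rfl
  have hstep := B.measurePreserving_groupStep.measurable
  have hcomp : B.groupStep ∘ Prod.map id q = q ∘ θ := rfl
  rw [averageImage, h1, Measure.map_map hstep (by fun_prop), hcomp, ← Measure.map_map hq
    hθ.measurable, ← hθR, (hθ.restrict_preimage hRm).map_eq]
  rfl

/-- If all the invariant functions on `X × G` depend on `G` only and are `H`-invariant, then the
law of `g⁻¹ z` does not depend on `x`, for almost every `g` in the `H`-invariant set `N`. -/
lemma ae_measure_inv_smul_mem {B : RandomCocycle f G} {H : Subgroup G}
    (hconst : ∀ v : Lp ℝ 2 (μ.prod (Measure.haar : Measure G)),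
      transferOp B.measurePreserving_groupStep v = v →
        ∃ φ : Lp ℝ 2 (Measure.haar : Measure G), (∀ k ∈ H, DomMulAct.mk k • φ = φ) ∧
          v =ᵐ[μ.prod Measure.haar] fun r => φ r.2)
    {π : Measure (X × Z)} [IsProbabilityMeasure π] (h : B.IsStationary π) {N : Set G}
    (hN : MeasurableSet N) (hNfin : (Measure.haar : Measure G) N < ∞)
    (hBN : ∀ i x, (fun g => B.map i x * g) ⁻¹' N = N)
    {D : Set Z} (hD : MeasurableSet D) :
    (∀ D', MeasurableSet D' → ∀ᵐ g ∂(Measure.haar.restrict N),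
      π {w | w.1 ∈ D' ∧ g⁻¹ • w.2 ∈ D} = μ D' * π {w | g⁻¹ • w.2 ∈ D}) ∧
    ∀ k ∈ H, (fun g => k * g) ⁻¹' N = N → ∀ᵐ g ∂(Measure.haar.restrict N),
      π {w | (k * g)⁻¹ • w.2 ∈ D} = π {w | g⁻¹ • w.2 ∈ D} := by
  have hmfin : IsFiniteMeasure ((Measure.haar : Measure G).restrict N) := ⟨by simpa using hNfin⟩
  have hΛfin : IsFiniteMeasure (transportMeasure π N D) := by
    unfold transportMeasure; infer_instance
  have hΛle := transportMeasure_le (N := N) (D := D) h.1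
  have hΛst := averageImage_transportMeasure h hN hBN hD
  -- the density of a stationary measure is a fixed vector, hence a function `φ` of `g` only
  have hfix : transferOp B.measurePreserving_groupStep (densityOfLe hΛle) = densityOfLe hΛle := by
    rw [transferOp_densityOfLe]
    congr 1
  obtain ⟨φ, hφ, hΛφ⟩ := hconst _ hfix
  have hφm : Measurable φ := (Lp.stronglyMeasurable φ).measurable
  have hrn : (transportMeasure π N D).rnDeriv (μ.prod (Measure.haar : Measure G)) =ᵐ[μ.prod
      Measure.haar] fun r => ENNReal.ofReal (φ r.2) := by
    filter_upwards [hΛφ, (memLp_rnDeriv_of_le hΛle).coeFn_toLp, Measure.rnDeriv_lt_top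
      (transportMeasure π N D) (μ.prod (Measure.haar : Measure G))] with r h1 h2 h3
    rw [← h1, densityOfLe, h2, ENNReal.ofReal_toReal h3.ne]
  have hΛ : transportMeasure π N D =
      μ.prod (Measure.haar.withDensity fun g => ENNReal.ofReal (φ g)) := by
    rw [prod_withDensity_right hφm.ennreal_ofReal, ← withDensity_congr_ae hrn,
      Measure.withDensity_rnDeriv_eq _ _ (Measure.absolutelyContinuous_of_le hΛle)]
  have hmeas : ∀ D', MeasurableSet D' →
      Measurable fun g : G => π {w | w.1 ∈ D' ∧ g⁻¹ • w.2 ∈ D} := fun D' hD' =>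
    measurable_measure_prodMk_right (((measurable_fst.comp measurable_fst) hD').inter
      (measurable_inv_smul_snd hD))
  -- disintegrate `transportMeasure π N D` over `g` for the points `x` in `D'`
  have key : ∀ D', MeasurableSet D' → (N.indicator fun g => π {w | w.1 ∈ D' ∧ g⁻¹ • w.2 ∈ D})
      =ᵐ[Measure.haar] fun g => μ D' * ENNReal.ofReal (φ g) := by
    intro D' hD'
    refine ae_eq_of_forall_setLIntegral_eq_of_sigmaFinite ((hmeas D' hD').indicator hN)
      (hφm.ennreal_ofReal.const_mul _) fun S hS _ => ?_
    have h1 : transportMeasure π N D (D' ×ˢ S) =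
        μ D' * ∫⁻ g in S, ENNReal.ofReal (φ g) ∂Measure.haar := by
      rw [hΛ, Measure.prod_prod, withDensity_apply _ hS]
    rw [lintegral_const_mul _ hφm.ennreal_ofReal, ← h1, transportMeasure_prod hD hD' hS,
      ← lintegral_indicator hS, ← lintegral_indicator hS, ← lintegral_indicator hN]
    refine lintegral_congr fun g => ?_
    by_cases h1 : g ∈ S <;> by_cases h2 : g ∈ N <;> simp [h1, h2]
  have key1 : (N.indicator fun g => π {w | g⁻¹ • w.2 ∈ D})
      =ᵐ[Measure.haar] fun g => ENNReal.ofReal (φ g) := by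
    simpa using key Set.univ .univ
  constructor
  · intro D' hD'
    filter_upwards [ae_restrict_mem hN, ae_restrict_of_ae (key D' hD'),
      ae_restrict_of_ae key1] with g hg h1 h2
    rw [Set.indicator_of_mem hg] at h1 h2
    rw [h1, h2]
  · intro k hk hkN
    have h1 := (measurePreserving_mul_left (Measure.haar : Measure G)
      k).quasiMeasurePreserving.ae key1
    have h2 := smul_Lp_ae_eq (DomMulAct.mk k) φ
    rw [hφ k hk] at h2
    filter_upwards [ae_restrict_mem hN, ae_restrict_of_ae h1, ae_restrict_of_ae h2,
      ae_restrict_of_ae key1] with g hg h3 h4 h5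
    have hkg : k * g ∈ N := hkN.ge hg
    rw [Set.indicator_of_mem hg] at h5
    rw [Set.indicator_of_mem hkg] at h3
    rw [h3, h5, h4]
    rfl

end RandomCocycle

/-! ### Stationary measures are products -/

namespace RandomCocycle

open scoped Pointwise ENNReal
open DomMulAct hiding mk

variable {Y X : Type*} [MeasurableSpace Y] [MeasurableSpace X] {p : Measure Y}
  [IsProbabilityMeasure p] {μ : Measure X} [IsProbabilityMeasure μ] {f : RandomTransformation p μ}
  {G : Type*} [Group G] [TopologicalSpace G] [IsTopologicalGroup G] [LocallyCompactSpace G]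
  [SecondCountableTopology G] [T2Space G] [MeasurableSpace G] [BorelSpace G]
  {Z : Type*} [MeasurableSpace Z] [MulAction G Z] [MeasurableSMul₂ G Z]

lemma exists_isCompact_mem_nhds_preimage_mul_left_eq {H : Subgroup G}
    (hH : IsCompact (H : Set G)) :
    ∃ N : Set G, IsCompact N ∧ N ∈ 𝓝 1 ∧ ∀ k ∈ H, (fun g => k * g) ⁻¹' N = N := by
  obtain ⟨U, hU, hU1⟩ := exists_compact_mem_nhds (1 : G)
  refine ⟨(H : Set G) * U, hH.mul hU,
    mem_of_superset hU1 fun u hu => ⟨1, H.one_mem, u, hu, one_mul u⟩, fun k hk => ?_⟩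
  ext g
  constructor
  · rintro ⟨a, ha, u, hu, hau⟩
    exact ⟨k⁻¹ * a, H.mul_mem (H.inv_mem hk) ha, u, hu, by
      simp only at hau ⊢; rw [mul_assoc, hau, inv_mul_cancel_left]⟩
  · rintro ⟨a, ha, u, hu, rfl⟩
    exact ⟨k * a, H.mul_mem hk ha, u, hu, by simp [mul_assoc]⟩

/-- If all the invariant functions on `X × G` depend on `G` only and are `H`-invariant, where `H`
is a compact group in which the cocycle takes its values, then the stationary measures on `X × Z`
are products of `μ` and of `H`-invariant measures. -/
theorem IsStationary.exists_eq_prod [MeasurableSpace.CountablyGenerated X]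
    [MeasurableSpace.CountablyGenerated Z] {B : RandomCocycle f G} {H : Subgroup G}
    (hH : IsCompact (H : Set G)) (hBH : ∀ i x, B.map i x ∈ H)
    (hconst : ∀ v : Lp ℝ 2 (μ.prod (Measure.haar : Measure G)),
      transferOp B.measurePreserving_groupStep v = v →
        ∃ φ : Lp ℝ 2 (Measure.haar : Measure G), (∀ k ∈ H, DomMulAct.mk k • φ = φ) ∧
          v =ᵐ[μ.prod Measure.haar] fun r => φ r.2)
    {π : Measure (X × Z)} [IsProbabilityMeasure π] (h : B.IsStationary π) :
    ∃ ν : Measure Z, IsProbabilityMeasure ν ∧ π = μ.prod ν ∧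
      ∀ k ∈ H, ν.map (fun z => k • z) = ν := by
  obtain ⟨N, hNc, hN1, hkN⟩ := exists_isCompact_mem_nhds_preimage_mul_left_eq hH
  have hN : MeasurableSet N := hNc.measurableSet
  have hNne : (Measure.haar : Measure G).restrict N ≠ 0 := by
    rw [Ne, Measure.restrict_eq_zero]
    exact (Measure.measure_pos_of_mem_nhds _ hN1).ne'
  have hne : NeBot (ae ((Measure.haar : Measure G).restrict N)) := ae_neBot.2 hNne
  have main := fun (D : Set Z) (hD : MeasurableSet D) => ae_measure_inv_smul_mem hconst h hN
    hNc.measure_lt_top (fun i x => hkN _ (hBH i x)) hD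
  obtain ⟨CX, hCX, hCXpi, hCXu, hCXg⟩ := exists_countable_isPiSystem_generateFrom X
  obtain ⟨CZ, hCZ, hCZpi, hCZu, hCZg⟩ := exists_countable_isPiSystem_generateFrom Z
  have hXm : ∀ D ∈ CX, MeasurableSet D := fun D hD =>
    hCXg ▸ MeasurableSpace.measurableSet_generateFrom hD
  have hZm : ∀ D ∈ CZ, MeasurableSet D := fun D hD =>
    hCZg ▸ MeasurableSpace.measurableSet_generateFrom hD
  have hsm : ∀ c : G, Measurable fun z : Z => c • z := fun c => measurable_const_smul c
  set ν : Measure Z := π.map Prod.snd with hν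
  have hνp : IsProbabilityMeasure ν := Measure.isProbabilityMeasure_map measurable_snd.aemeasurable
  have hνap : ∀ (c : G) (D : Set Z), MeasurableSet D →
      ν.map (fun z => c • z) D = π {w | c • w.2 ∈ D} := by
    intro c D hD
    rw [Measure.map_apply (hsm c) hD, hν, Measure.map_apply measurable_snd (hsm c hD)]
    rfl
  have hνc : ∀ c : G, IsProbabilityMeasure (ν.map fun z => c • z) := fun c =>
    Measure.isProbabilityMeasure_map (hsm c).aemeasurable
  refine ⟨ν, hνp, ?_, ?_⟩
  -- in both parts, a single generic `g` gives an identity between laws of `g⁻¹ z`, from which `g⁻¹`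
  -- is then removed by applying `g`
  · have hae : ∀ᵐ g ∂((Measure.haar : Measure G).restrict N), ∀ D' ∈ CX, ∀ D ∈ CZ,
        π {w | w.1 ∈ D' ∧ g⁻¹ • w.2 ∈ D} = μ D' * π {w | g⁻¹ • w.2 ∈ D} :=
      (ae_ball_iff hCX).2 fun D' hD' => (ae_ball_iff hCZ).2 fun D hD =>
        (main D (hZm D hD)).1 D' (hXm D' hD')
    obtain ⟨g, hg⟩ := hae.exists
    have hgm : Measurable (Prod.map (id : X → X) fun z : Z => g⁻¹ • z) :=
      measurable_id.prodMap (hsm _)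
    have h1 : π.map (Prod.map id fun z => g⁻¹ • z) = μ.prod (ν.map fun z => g⁻¹ • z) := by
      have : IsProbabilityMeasure (π.map (Prod.map id fun z => g⁻¹ • z)) :=
        Measure.isProbabilityMeasure_map hgm.aemeasurable
      refine ext_of_generate_finite (Set.image2 (· ×ˢ ·) CX CZ) ?_ (hCXpi.prod hCZpi) ?_ (by simp)
      · rw [← generateFrom_prod_eq ⟨fun _ => Set.univ, fun _ => hCXu, Set.iUnion_const _⟩
          ⟨fun _ => Set.univ, fun _ => hCZu, Set.iUnion_const _⟩, hCXg, hCZg]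
      · rintro _ ⟨D', hD', D, hD, rfl⟩
        rw [Measure.map_apply hgm ((hXm D' hD').prod (hZm D hD)), Measure.prod_prod,
          hνap _ D (hZm D hD), ← hg D' hD' D hD]
        rfl
    have h2 := congrArg (Measure.map (Prod.map (id : X → X) fun z : Z => g • z)) h1
    rw [Measure.map_map (measurable_id.prodMap (hsm _)) hgm,
      ← Measure.map_prod_map _ _ measurable_id (hsm _), Measure.map_map (hsm _) (hsm _),
      Measure.map_id] at h2
    have e1 : Prod.map (id : X → X) (fun z : Z => g • z) ∘ Prod.map id (fun z => g⁻¹ • z) = id := by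
      funext w
      exact Prod.ext rfl (smul_inv_smul g w.2)
    have e2 : (fun z : Z => g • z) ∘ (fun z => g⁻¹ • z) = id := by
      funext z
      simp
    rwa [e1, e2, Measure.map_id, Measure.map_id] at h2
  · intro k hk
    have hae : ∀ᵐ g ∂((Measure.haar : Measure G).restrict N), ∀ D ∈ CZ,
        π {w | (k * g)⁻¹ • w.2 ∈ D} = π {w | g⁻¹ • w.2 ∈ D} :=
      (ae_ball_iff hCZ).2 fun D hD => (main D (hZm D hD)).2 k hk (hkN k hk)
    obtain ⟨g, hg⟩ := hae.exists
    have h1 : (ν.map fun z => (k * g)⁻¹ • z) = ν.map fun z => g⁻¹ • z :=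
      ext_of_generate_finite CZ hCZg.symm hCZpi (fun D hD => by
        rw [hνap _ D (hZm D hD), hνap _ D (hZm D hD), hg D hD]) (by simp)
    have h2 := congrArg (Measure.map fun z => (k * g) • z) h1
    rw [Measure.map_map (hsm _) (hsm _), Measure.map_map (hsm _) (hsm _)] at h2
    have e1 : (fun z : Z => (k * g) • z) ∘ (fun z => (k * g)⁻¹ • z) = id := by
      funext z
      simp only [Function.comp_apply, smul_inv_smul, id]
    have e2 : (fun z : Z => (k * g) • z) ∘ (fun z => g⁻¹ • z) = fun z => k • z := by
      funext z
      simp [mul_smul]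
    rw [e1, e2, Measure.map_id] at h2
    exact h2.symm

lemma isInvariant_prod [MeasurableSpace.CountablyGenerated X] {B : RandomCocycle f G}
    {H : Subgroup G} (hBH : ∀ i x, B.map i x ∈ H) {ν : Measure Z} [IsProbabilityMeasure ν]
    (hν : ∀ k ∈ H, ν.map (fun z => k • z) = ν) : B.IsInvariant (μ.prod ν) := by
  refine ⟨measurePreserving_fst.map_eq, ?_⟩
  filter_upwards [f.ae_map_eq] with i hi
  have h1 : MeasurePreserving (f.map i) μ μ :=
    ⟨f.measurable_map.comp measurable_prodMk_left, hi⟩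
  have h2 : Measurable (Function.uncurry fun (x : X) (z : Z) => B.map i x • z) :=
    ((B.measurable.comp measurable_prodMk_left).comp measurable_fst).smul measurable_snd
  exact (h1.skew_product h2 (ae_of_all _ fun x => hν _ (hBH i x))).map_eq

end RandomCocycle

/-! ### The linear group and the projective space -/

section GeneralLinearGroup

variable {d : ℕ}

instance : BorelSpace (GL (Fin d) ℝ) := ⟨rfl⟩

instance : SecondCountableTopology (Matrix (Fin d) (Fin d) ℝ) :=
  inferInstanceAs (SecondCountableTopology (Fin d → Fin d → ℝ))

instance : LocallyCompactSpace (Matrix (Fin d) (Fin d) ℝ) :=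
  inferInstanceAs (LocallyCompactSpace (Fin d → Fin d → ℝ))

instance : SecondCountableTopology (GL (Fin d) ℝ) :=
  have : SecondCountableTopology (Matrix (Fin d) (Fin d) ℝ)ᵐᵒᵖ :=
    MulOpposite.opHomeomorph.symm.secondCountableTopology
  Units.isEmbedding_embedProduct.secondCountableTopology

instance : LocallyCompactSpace (GL (Fin d) ℝ) :=
  Units.isClosedEmbedding_embedProduct.locallyCompactSpace

lemma isOpenQuotientMap_projectivization_mk :
    IsOpenQuotientMap fun v : {v : Fin d → ℝ // v ≠ 0} => Projectivization.mk ℝ v.1 v.2 := by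
  refine ⟨fun z => ?_, continuous_coinduced_rng, fun U hU => ?_⟩
  · induction z using Projectivization.ind with
    | h v hv => exact ⟨⟨v, hv⟩, rfl⟩
  · -- the saturation of an open set is the union of its multiples
    rw [isOpen_coinduced]
    have h1 : (fun v : {v : Fin d → ℝ // v ≠ 0} => Projectivization.mk ℝ v.1 v.2) ⁻¹'
        ((fun v : {v : Fin d → ℝ // v ≠ 0} => Projectivization.mk ℝ v.1 v.2) '' U) =
        ⋃ c : ℝˣ, (fun v : {v : Fin d → ℝ // v ≠ 0} =>
          (⟨c • v.1, (smul_ne_zero_iff_ne c).2 v.2⟩ : {v : Fin d → ℝ // v ≠ 0})) ⁻¹' U := by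
      ext v
      simp only [Set.mem_preimage, Set.mem_image, Set.mem_iUnion]
      constructor
      · rintro ⟨u, hu, huv⟩
        obtain ⟨c, hc⟩ := (Projectivization.mk_eq_mk_iff ℝ _ _ _ _).1 huv
        exact ⟨c, by convert hu⟩
      · rintro ⟨c, hc⟩
        exact ⟨_, hc, (Projectivization.mk_eq_mk_iff ℝ _ _ _ _).2 ⟨c, rfl⟩⟩
    rw [h1]
    refine isOpen_iUnion fun c => hU.preimage ?_
    exact (continuous_subtype_val.const_smul c).subtype_mk _

instance : SecondCountableTopology (ℙ ℝ (Fin d → ℝ)) :=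
  isOpenQuotientMap_projectivization_mk.isQuotientMap.secondCountableTopology
    isOpenQuotientMap_projectivization_mk.isOpenMap

instance : BorelSpace (ℙ ℝ (Fin d → ℝ)) := ⟨rfl⟩

instance : ContinuousSMul (GL (Fin d) ℝ) (ℙ ℝ (Fin d → ℝ)) := by
  refine ⟨?_⟩
  have hq := isOpenQuotientMap_projectivization_mk (d := d)
  have hq2 := (IsOpenQuotientMap.id (X := GL (Fin d) ℝ)).prodMap hq
  rw [← hq2.continuous_comp_iff]
  have h1 : Continuous fun r : GL (Fin d) ℝ × {v : Fin d → ℝ // v ≠ 0} =>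
      (r.1 : Matrix (Fin d) (Fin d) ℝ) *ᵥ r.2.1 :=
    Continuous.matrix_mulVec (Units.continuous_val.comp continuous_fst)
      (continuous_subtype_val.comp continuous_snd)
  have h2 : ∀ r : GL (Fin d) ℝ × {v : Fin d → ℝ // v ≠ 0},
      (r.1 : Matrix (Fin d) (Fin d) ℝ) *ᵥ r.2.1 ≠ 0 := fun r =>
    (smul_ne_zero_iff_ne r.1).2 r.2.2
  exact hq.continuous.comp (h1.subtype_mk h2)

instance : MeasurableSMul₂ (GL (Fin d) ℝ) (ℙ ℝ (Fin d → ℝ)) :=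
  ⟨continuous_smul.measurable⟩

open scoped MatrixOrder in
/-- A compact group of matrices preserves an inner product: the integral of `g gᵀ` over a compact
neighbourhood of the identity which is invariant under the group. -/
lemma exists_conj_mem_orthogonalGroup {H : Subgroup (GL (Fin d) ℝ)}
    (hH : IsCompact (H : Set (GL (Fin d) ℝ))) :
    ∃ c : GL (Fin d) ℝ, ∀ k ∈ H,
      ((c⁻¹ * k * c : GL (Fin d) ℝ) : Matrix (Fin d) (Fin d) ℝ) ∈
        Matrix.orthogonalGroup (Fin d) ℝ := by
  obtain ⟨N, hNc, hN1, hkN⟩ :=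
    RandomCocycle.exists_isCompact_mem_nhds_preimage_mul_left_eq hH
  let M : GL (Fin d) ℝ → Matrix (Fin d) (Fin d) ℝ := fun g => g.1 * g.1ᵀ
  have hM : Continuous M :=
    Units.continuous_val.matrix_mul Units.continuous_val.matrix_transpose
  let m : Measure (GL (Fin d) ℝ) := Measure.haar.restrict N
  let q : Matrix (Fin d) (Fin d) ℝ := Matrix.of fun i j => ∫ g, M g i j ∂m
  have hint : ∀ i j, Integrable (fun g => M g i j) m := fun i j =>
    (hM.matrix_elem i j).continuousOn.integrableOn_compact hNc
  have hform : ∀ v w, v ⬝ᵥ q *ᵥ w = ∫ g, v ⬝ᵥ M g *ᵥ w ∂m := by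
    intro v w
    simp only [dotProduct, Matrix.mulVec, q, Matrix.of_apply]
    rw [integral_finsetSum _ fun i _ => ?_]
    · refine Finset.sum_congr rfl fun i _ => ?_
      rw [integral_const_mul, integral_finsetSum _ fun j _ => (hint i j).mul_const _]
      simp only [integral_mul_const]
    · exact (integrable_finsetSum _ fun j _ => (hint i j).mul_const _).const_mul _
  have hMform : ∀ g v w, v ⬝ᵥ M g *ᵥ w = (g.1ᵀ *ᵥ v) ⬝ᵥ (g.1ᵀ *ᵥ w) := by
    intro g v w
    rw [← Matrix.mulVec_mulVec, Matrix.dotProduct_mulVec, Matrix.mulVec_transpose,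
      Matrix.mulVec_transpose]
  -- the form `q` is invariant because left translation by `k ∈ H` preserves `haar|N`
  have hinv : ∀ k ∈ H, k.1 * q * k.1ᵀ = q := by
    intro k hk
    have hmp : MeasurePreserving (fun g => k * g) m m := by
      have := (measurePreserving_mul_left (Measure.haar : Measure (GL (Fin d) ℝ))
        k).restrict_preimage hNc.measurableSet
      rwa [hkN k hk] at this
    refine Matrix.ext_of_mulVec_single fun j => ?_
    refine dotProduct_eq _ _ fun u => ?_
    rw [dotProduct_comm, dotProduct_comm _ u, hform, ← Matrix.mulVec_mulVec,
      ← Matrix.mulVec_mulVec, Matrix.dotProduct_mulVec, ← Matrix.mulVec_transpose, hform]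
    conv_rhs => rw [← hmp.integral_comp (MeasurableEquiv.mulLeft k).measurableEmbedding]
    refine integral_congr_ae (ae_of_all _ fun g => ?_)
    simp only [hMform]
    rw [Matrix.mulVec_mulVec, Matrix.mulVec_mulVec, ← Matrix.transpose_mul]
    rfl
  have hpos : q.PosDef := by
    refine .of_dotProduct_mulVec_pos ?_ fun v hv => ?_
    · ext i j
      simp only [q, M, Matrix.conjTranspose_apply, Matrix.of_apply, star_trivial, Matrix.mul_apply,
        Matrix.transpose_apply]
      exact integral_congr_ae (ae_of_all _ fun g => Finset.sum_congr rfl fun a _ => mul_comm _ _)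
    · rw [star_trivial, hform]
      have hp : ∀ g : GL (Fin d) ℝ, 0 < v ⬝ᵥ M g *ᵥ v := by
        intro g
        rw [hMform]
        have h1 : g.1ᵀ *ᵥ v ≠ 0 := by
          intro h0
          apply hv
          have h2 : (g⁻¹).1ᵀ *ᵥ (g.1ᵀ *ᵥ v) = v := by
            rw [Matrix.mulVec_mulVec, ← Matrix.transpose_mul, ← Units.val_mul, mul_inv_cancel]
            simp
          rw [← h2, h0, Matrix.mulVec_zero]
        exact lt_of_le_of_ne (by simpa using dotProduct_star_self_nonneg (g.1ᵀ *ᵥ v))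
          fun h0 => h1 (dotProduct_self_eq_zero.1 h0.symm)
      have hi : Integrable (fun g => v ⬝ᵥ M g *ᵥ v) m :=
        ((continuous_const.dotProduct (hM.matrix_mulVec
          continuous_const)).continuousOn).integrableOn_compact hNc
      rw [integral_pos_iff_support_of_nonneg (fun g => (hp g).le) hi]
      have : Function.support (fun g => v ⬝ᵥ M g *ᵥ v) = Set.univ :=
        Set.eq_univ_of_forall fun g => (hp g).ne'
      rw [this, Measure.restrict_apply_univ]
      exact Measure.measure_pos_of_mem_nhds _ hN1
  obtain ⟨y, hy⟩ := CStarAlgebra.nonneg_iff_eq_star_mul_self.mp hpos.posSemidef.nonneg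
  have hydet : IsUnit yᵀ := by
    rw [Matrix.isUnit_iff_isUnit_det, Matrix.det_transpose, isUnit_iff_ne_zero]
    intro h0
    have h1 := hpos.det_pos
    rw [hy, Matrix.det_mul, h0, mul_zero] at h1
    exact lt_irrefl _ h1
  obtain ⟨c, hc⟩ := hydet
  have hq : q = c.1 * c.1ᵀ := by
    rw [hy, hc, Matrix.transpose_transpose, Matrix.star_eq_conjTranspose,
      Matrix.conjTranspose_eq_transpose_of_trivial]
  refine ⟨c, fun k hk => ?_⟩
  rw [Matrix.mem_orthogonalGroup_iff]
  have h1 := hinv k hk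
  rw [hq] at h1
  have h2 : (c⁻¹).1 * c.1 = 1 := by rw [← Units.val_mul, inv_mul_cancel, Units.val_one]
  calc (c⁻¹ * k * c : GL (Fin d) ℝ).1 * ((c⁻¹ * k * c : GL (Fin d) ℝ).1)ᵀ
      = (c⁻¹).1 * (k.1 * (c.1 * c.1ᵀ) * k.1ᵀ) * ((c⁻¹).1)ᵀ := by
        simp only [Units.val_mul, Matrix.transpose_mul, Matrix.mul_assoc]
    _ = ((c⁻¹).1 * c.1) * ((c⁻¹).1 * c.1)ᵀ := by
        rw [h1, Matrix.transpose_mul]; simp only [Matrix.mul_assoc]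
    _ = 1 := by rw [h2]; simp

end GeneralLinearGroup

/-! ### Reduction to a compact group -/

lemma mem_translationStabilizer_smul {G : Type*} [Group G] [TopologicalSpace G]
    [IsTopologicalGroup G] [LocallyCompactSpace G] [SecondCountableTopology G] [T2Space G]
    [MeasurableSpace G] [BorelSpace G] {ι : Type*} {w : ι → Lp ℝ 2 (Measure.haar : Measure G)}
    {c k : G} :
    k ∈ translationStabilizer (DomMulAct.mk c • w) ↔ c * k * c⁻¹ ∈ translationStabilizer w := by
  rw [mem_translationStabilizer, mem_translationStabilizer, DomMulAct.mk_mul, DomMulAct.mk_mul,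
    DomMulAct.mk_inv, mul_smul, mul_smul, inv_smul_eq_iff]

end

theorem mainTheorem9 {Y X : Type*} [MeasurableSpace Y] [MeasurableSpace X] [StandardBorelSpace X]
    (p : Measure Y) [IsProbabilityMeasure p] (μ : Measure X) [IsProbabilityMeasure μ]
    (f : RandomTransformation p μ) (d : ℕ)
    (A : RandomCocycle f (GL (Fin d) ℝ)) (hA : A.EssentiallyBounded) :
    ∃ (H : Subgroup (GL (Fin d) ℝ)) (B : RandomCocycle f (GL (Fin d) ℝ)),
      IsCompact (H : Set (GL (Fin d) ℝ)) ∧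
      (∀ g ∈ H, (g : Matrix (Fin d) (Fin d) ℝ) ∈ Matrix.orthogonalGroup (Fin d) ℝ) ∧
      (∀ i x, B.map i x ∈ H) ∧
      A.Cohomologous B ∧
      (∀ π : Measure (X × ℙ ℝ (Fin d → ℝ)), IsProbabilityMeasure π → B.IsStationary π →
        (∃ ν : Measure (ℙ ℝ (Fin d → ℝ)), IsProbabilityMeasure ν ∧ π = μ.prod ν) ∧
        B.IsInvariant π) := by
  obtain ⟨h₀, hne, hfix⟩ := A.exists_ne_zero_transferOp_eq hA
  let S : Set (Lp ℝ 2 (μ.prod (Measure.haar : Measure (GL (Fin d) ℝ)))) :=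
    {u | transferOp A.measurePreserving_groupStep u = u}
  have : Nonempty S := ⟨⟨h₀, hfix⟩⟩
  obtain ⟨h, hh⟩ := TopologicalSpace.exists_dense_seq S
  have hdense : ∀ u, transferOp A.measurePreserving_groupStep u = u →
      u ∈ closure (Set.range fun n => (h n).1) := by
    intro u hu
    have h1 := closure_subtype.1 (hh ⟨u, hu⟩)
    rwa [← Set.range_comp] at h1
  obtain ⟨n, hn⟩ : ∃ n, (h n).1 ≠ 0 := by
    by_contra! h0
    have hr : (Set.range fun n => (h n).1) ⊆ {0} := by
      rintro _ ⟨k, rfl⟩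
      exact h0 k
    have h1 := closure_mono hr (hdense h₀ hfix)
    rw [closure_singleton] at h1
    exact hne h1
  obtain ⟨w₀, P₀, hw₀n, hP₀, hw₀⟩ :=
    A.exists_measurable_mk_smul_slice_eq (fun k => (h k).2) hn
  obtain ⟨c, hc⟩ := exists_conj_mem_orthogonalGroup (isCompact_translationStabilizer hw₀n)
  -- translating the family `w₀` by `c` conjugates its stabilizer into the orthogonal group
  let w := DomMulAct.mk c • w₀
  have hwn : w n ≠ 0 := by
    have h1 : ‖w n‖ = ‖w₀ n‖ := DomMulAct.norm_smul_Lp _ _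
    rwa [← norm_ne_zero_iff, h1, norm_ne_zero_iff]
  let P : X → GL (Fin d) ℝ := fun x => P₀ x * c
  have hP : Measurable P := hP₀.mul_const c
  have hw : ∀ᵐ x ∂μ, ∀ k, DomMulAct.mk (P x) • slice (h k).1 x = w k := by
    filter_upwards [hw₀] with x hx k
    rw [DomMulAct.mk_mul, mul_smul, hx k]
    rfl
  let H : Subgroup (GL (Fin d) ℝ) := translationStabilizer w
  have hH : IsCompact (H : Set (GL (Fin d) ℝ)) := isCompact_translationStabilizer hwn
  let B := A.conjugate hP hH.measurableSet
  have hBH : ∀ i x, B.map i x ∈ H := A.conjugate_mem hP hH.measurableSet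
  have hB : ∀ᵐ q ∂(p.prod μ),
      B.map q.1 q.2 = (P (f.map q.1 q.2))⁻¹ * A.map q.1 q.2 * P q.2 := by
    filter_upwards [A.ae_conj_mem_translationStabilizer (fun k => (h k).2) hw] with q hq
    exact if_pos hq
  refine ⟨H, B, hH, fun g hg => ?_, hBH, RandomCocycle.cohomologous_of_ae_map_eq hP hB,
    fun π hπ hst => ?_⟩
  · have h1 := hc _ (mem_translationStabilizer_smul.1 hg)
    rwa [show c⁻¹ * (c * g * c⁻¹) * c = g by group] at h1
  · obtain ⟨ν, hν, rfl, hνH⟩ := hst.exists_eq_prod hH hBH fun v hv =>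
      RandomCocycle.exists_ae_eq_snd_of_transferOp_eq hdense hP hw hB hv
    exact ⟨⟨ν, hν, rfl⟩, RandomCocycle.isInvariant_prod hBH hνH⟩
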